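/- Let $q\in\mathbb{C}\setminus\{0\}$ with $q^m\neq 1$ for all integers $m\ge 1$, and let $c\in\mathbb{C}$ with $c^2\in\mathbb{R}\setminus\{0\}$. Let $N\ge 3$, $i'=N+1-i$, let $\rho_i=\frac N2-i$ if $i<i'$, $\rho_i=-(\frac N2-i')$ if $i>i'$, and $\rho_i=0$ if $i=i'$. Put $$C^{ij}=C_{ij}=q^{-2\rho_i}\delta_{i,j'},\qquad K^{ij}_{kl}=C^{ij}C_{kl},\qquad \hat R^{ij}_{kl}=q^{2\delta_{i,j}-2\delta_{i,j'}}\delta_{i,l}\delta_{j,k}+(q^2-q^{-2})\,\delta_{i<l}\,(\delta_{i,k}\delta_{j,l}-K^{ij}_{kl}),$$ where $\delta_{i<l}=1$ if $i<l$ and $0$ otherwise, and $$P_+=\frac{1}{q^2+q^{-2}}\Bigl(q^{-2}\,\mathrm{id}+\hat R-\frac{(q+q^{-1})(q-q^{-1})}{q^{2N}-1}K\Bigr).$$ Let $\mathrm{Cl}_q(N)$ be the complex unital algebra generated by $\gamma_1,\dots,\gamma_N$ with the relations $\sum_{k,l}(P_+)^{kl}_{ij}\gamma_k\gamma_l=0$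 for all $i,j$, and $\sum_{i,j}C^{ij}\gamma_i\gamma_j=c^2\frac{q^{2N}-1}{q^2-1}$. Let $\mathrm{Cl}_q(N)_1$ be its odd part, the linear span of all products of an odd number of generators. For $J=(j_1,\dots,j_n)\in\{0,1\}^n$ write $\ell(J)=\sum_k j_k$ and $L(J)=\sum_k k\,j_k$. (a) Let $N=2n\ge 3$. The element $$z_0=\sum_{k=0}^n(-1)^k\Bigl(\prod_{l=1}^k\frac{q^{2l-2}+q^{-2l+2}}{q(q+q^{-1})c^2}\Bigr)\sum_{\ell(J)=k}q^{2L(J)-k(2n-k+1)}\,\gamma_1^{j_1}\gamma_2^{j_2}\cdots\gamma_n^{j_n}\gamma_{n+1}^{j_n}\cdots\gamma_{2n}^{j_1}\in\mathrm{Cl}_q(2n)$$ is nonzero and satisfies $z_0\gamma_i=-\gamma_iz_0$ for $i=1,\dots,2n$; every $z\in\mathrm{Cl}_q(2n)$ with $z\gamma_i=-\gamma_iz$ for all $i$ is a complex multiple of $z_0$. (b) Let $N=2n+1\ge 3$. The element $$z_1=\frac1c\sum_{k=0}^n\Bigl(\prod_{l=1}^k\frac{q^{2l-1}+q^{-2l+1}}{q(q+q^{-1})c^2}\Bigr)\sum_{\ell(J)=k}q^{2L(J)-k(2n-k+1)}\,\gamma_1^{j_1}\cdots\gamma_n^{j_n}\,\gamma_{n+1}\,\gamma_{n+2}^{j_n}\cdots\gamma_{2n+1}^{j_1}$$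 lies in the odd part $\mathrm{Cl}_q(2n+1)_1$, is nonzero and satisfies $z_1\gamma_i=\gamma_iz_1$ for $i=1,\dots,2n+1$; every $z\in\mathrm{Cl}_q(2n+1)_1$ with $z\gamma_i=\gamma_iz$ for all $i$ is a complex multiple of $z_1$. -/

import Mathlib

noncomputable section

namespace FRTClifford

/-! Indices `1, …, N` are the elements of `Fin N`, shifted by one: the index called `i + 1` in the
usual numbering is `i : Fin N`. The conjugate index `i' = N + 1 - i` is `Fin.rev i`. -/

/-- The integer `2 ρ_i`, where `ρ_i = N/2 - i` if `i < i'`, `ρ_i = -(N/2 - i')` if `i' < i`, and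
`ρ_i = 0` if `i = i'` (with `i` numbered from one). -/
def twoRho {N : ℕ} (i : Fin N) : ℤ :=
  if i < i.rev then (N : ℤ) - 2 * ((i : ℤ) + 1)
  else if i.rev < i then -((N : ℤ) - 2 * ((i.rev : ℤ) + 1))
  else 0

/-- The metric `C^{ij} = C_{ij} = q^{-2ρ_i} δ^i_{j'}`. -/
def metricC (q : ℂ) {N : ℕ} (i j : Fin N) : ℂ :=
  if i = j.rev then q ^ (-twoRho i) else 0

/-- The matrix `K^{ij}_{kl} = C^{ij} C_{kl}`, with row index `(i, j)` and column index `(k, l)`. -/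
def matK (q : ℂ) (N : ℕ) : Matrix (Fin N × Fin N) (Fin N × Fin N) ℂ :=
  fun ij kl => metricC q ij.1 ij.2 * metricC q kl.1 kl.2

/-- Kronecker's symbol with integer values. -/
def kron {N : ℕ} (i j : Fin N) : ℤ := if i = j then 1 else 0

/-- The braid matrix of the orthogonal quantum group,
`R^{ij}_{kl} = q^{2δ^i_j - 2δ^i_{j'}} δ^i_l δ^j_k
  + (q² - q⁻²) δ_{i<l} (δ^i_k δ^j_l - K^{ij}_{kl})`,
with row index `(i, j)` and column index `(k, l)`. -/
def matR (q : ℂ) (N : ℕ) : Matrix (Fin N × Fin N) (Fin N × Fin N) ℂ :=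
  fun ij kl =>
    q ^ (2 * kron ij.1 ij.2 - 2 * kron ij.1 ij.2.rev) * (kron ij.1 kl.2 : ℂ) * (kron ij.2 kl.1 : ℂ)
      + (q ^ 2 - (q ^ 2)⁻¹) * (if ij.1 < kl.2 then 1 else 0) *
          ((kron ij.1 kl.1 : ℂ) * (kron ij.2 kl.2 : ℂ) - matK q N ij kl)

/-- The projector
`P₊ = (q² + q⁻²)⁻¹ (q⁻² id + R - (q + q⁻¹)(q - q⁻¹) / (q^{2N} - 1) K)`. -/
def projPlus (q : ℂ) (N : ℕ) : Matrix (Fin N × Fin N) (Fin N × Fin N) ℂ :=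
  (1 / (q ^ 2 + (q ^ 2)⁻¹)) •
    ((q ^ 2)⁻¹ • (1 : Matrix (Fin N × Fin N) (Fin N × Fin N) ℂ) + matR q N
      - ((q + q⁻¹) * (q - q⁻¹) / (q ^ (2 * N) - 1)) • matK q N)

/-- The defining relations of the FRT–Clifford algebra: `∑ P₊^{kl}_{ij} γ_k γ_l = 0` for all
`i, j`, and `∑ C^{ij} γ_i γ_j = c² (q^{2N} - 1) / (q² - 1)`. -/
inductive Rel (q c : ℂ) (N : ℕ) : FreeAlgebra ℂ (Fin N) → FreeAlgebra ℂ (Fin N) → Prop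
  | projPlus (i j : Fin N) :
      Rel q c N
        (∑ k : Fin N, ∑ l : Fin N,
          projPlus q N (k, l) (i, j) • (FreeAlgebra.ι ℂ k * FreeAlgebra.ι ℂ l)) 0
  | metric :
      Rel q c N
        (∑ i : Fin N, ∑ j : Fin N, metricC q i j • (FreeAlgebra.ι ℂ i * FreeAlgebra.ι ℂ j))
        (algebraMap ℂ (FreeAlgebra ℂ (Fin N)) (c ^ 2 * ((q ^ (2 * N) - 1) / (q ^ 2 - 1))))

/-- The FRT–Clifford algebra `Cl_q(N; c)`: the complex unital algebra generated by `γ_1, …, γ_N`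
subject to the relations `Rel`. -/
abbrev Cl (q c : ℂ) (N : ℕ) : Type := RingQuot (Rel q c N)

/-- The generator `γ_{i+1}` of `Cl_q(N; c)`. -/
def gam (q c : ℂ) {N : ℕ} (i : Fin N) : Cl q c N :=
  RingQuot.mkAlgHom ℂ (Rel q c N) (FreeAlgebra.ι ℂ i)

/-- The odd component of `Cl_q(N; c)` for the `ℤ/2`-grading in which every generator is odd: the
span of all products of an odd number of generators. -/
def oddPart (q c : ℂ) (N : ℕ) : Submodule ℂ (Cl q c N) :=
  Submodule.span ℂ {x | ∃ w : List (Fin N), Odd w.length ∧ x = (w.map (gam q c)).prod}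

/-- `ℓ(J) = ∑ j_k` for a multi-index `J = (j_1, …, j_n)` with entries in `{0, 1}`. -/
def ell {n : ℕ} (J : Fin n → Fin 2) : ℕ := ∑ i, (J i : ℕ)

/-- `L(J) = ∑ k j_k`, with `k` running from `1` to `n`. -/
def bigL {n : ℕ} (J : Fin n → Fin 2) : ℕ := ∑ i : Fin n, ((i : ℕ) + 1) * (J i : ℕ)

/-- The ordered product `γ_1^{j_1} γ_2^{j_2} ⋯ γ_n^{j_n}` in `Cl_q(N; c)`, `n ≤ N`. -/
def leftProd (q c : ℂ) {n N : ℕ} (h : n ≤ N) (J : Fin n → Fin 2) : Cl q c N :=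
  ((List.finRange n).map fun i => gam q c (Fin.castLE h i) ^ (J i : ℕ)).prod

/-- The ordered product `γ_{n'}^{j_n} ⋯ γ_{2'}^{j_2} γ_{1'}^{j_1}` in `Cl_q(N; c)`, `n ≤ N`. -/
def rightProd (q c : ℂ) {n N : ℕ} (h : n ≤ N) (J : Fin n → Fin 2) : Cl q c N :=
  ((List.finRange n).reverse.map fun i => gam q c (Fin.castLE h i).rev ^ (J i : ℕ)).prod

/-- The element
`z_0 = ∑_{k=0}^n (-1)^k (∏_{l=1}^k (q^{2l-2} + q^{-2l+2}) / (q (q + q⁻¹) c²))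
  ∑_{ℓ(J)=k} q^{2L(J) - k(2n-k+1)} γ_1^{j_1} ⋯ γ_n^{j_n} γ_{n+1}^{j_n} ⋯ γ_{2n}^{j_1}`
of `Cl_q(2n; c)`. -/
def z0 (q c : ℂ) (n : ℕ) : Cl q c (2 * n) :=
  ∑ k ∈ Finset.range (n + 1),
    ((-1 : ℂ) ^ k * ∏ l ∈ Finset.Icc 1 k,
        (q ^ (2 * (l : ℤ) - 2) + q ^ (-2 * (l : ℤ) + 2)) / (q * (q + q⁻¹) * c ^ 2)) •
      ∑ J : Fin n → Fin 2 with ell J = k,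
        q ^ (2 * (bigL J : ℤ) - (k : ℤ) * (2 * (n : ℤ) - (k : ℤ) + 1)) •
          (leftProd q c (by omega) J * rightProd q c (by omega) J)

/-- The element
`z_1 = c⁻¹ ∑_{k=0}^n (∏_{l=1}^k (q^{2l-1} + q^{-2l+1}) / (q (q + q⁻¹) c²))
  ∑_{ℓ(J)=k} q^{2L(J) - k(2n-k+1)} γ_1^{j_1} ⋯ γ_n^{j_n} γ_{n+1} γ_{n+2}^{j_n} ⋯ γ_{2n+1}^{j_1}`
of `Cl_q(2n+1; c)`. -/
def z1 (q c : ℂ) (n : ℕ) : Cl q c (2 * n + 1) :=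
  (1 / c) • ∑ k ∈ Finset.range (n + 1),
    (∏ l ∈ Finset.Icc 1 k,
        (q ^ (2 * (l : ℤ) - 1) + q ^ (-2 * (l : ℤ) + 1)) / (q * (q + q⁻¹) * c ^ 2)) •
      ∑ J : Fin n → Fin 2 with ell J = k,
        q ^ (2 * (bigL J : ℤ) - (k : ℤ) * (2 * (n : ℤ) - (k : ℤ) + 1)) •
          (leftProd q c (by omega) J * gam q c (⟨n, by omega⟩ : Fin (2 * n + 1)) *
            rightProd q c (by omega) J)

end FRTClifford

end

noncomputable section

namespace FRTClifford

/-! The algebra is peeled from the outside. Let `D_t` be the affine function `metricDef` of the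
partial sums of the metric relation. The defining relations are equivalent to those of
`IsCliffordFamily`: distinct non-conjugate generators `-q²`-commute, non-middle squares vanish, and
each conjugate pair (or middle square) is governed by some `D_t`. In particular the outer generators
`u = x_1`, `w = x_N` satisfy `u² = w² = 0` and `uw + wu = d` with `d` a nonzero scalar, so `p =
uw/d` is an idempotent. Put `r^p = 1 + (r - 1)p`. Multiplying every other generator by `(-q⁻²)^p`
makes it commute with `u` and `w`, and the rescaled generators again form a Clifford family, shorter
by two, with the same `q` and `c` (`IsCliffordFamily.inner`).

The pair `u, w` acts like a copy of the `2 × 2` matrices, so an element commuting with both lies in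
the inner subalgebra (`mem_of_commute_pair`). By induction the center is the scalars for even
length, and lies in the algebra generated by one element `Z` for odd length. The explicit sums are
adapted to the peeling (`nestedSum_succ`): the even one is the inner one times `(-1)^p`, and the odd
one, without the factor `1/c`, equals the inner one. Hence the even element has square `1` and
anticommutes with all generators, while `Z` is central with square `c²`.

If `z` anticommutes with all generators then `z z_0` is central, hence a scalar, and `z` is a
multiple of `z_0`. In odd length a central element is `a + bZ`, and the parity automorphism removes
`a` when it is odd. Nonvanishing follows from the squares once the algebra is known to be
nontrivial; running the peeling backwards builds a representation by `2 × 2` block matrices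
(`exists_isCliffordFamily`). -/

/-- The partial sums `∑_{k<t} C^{kk'} x_k x_{k'}` of the metric relation. -/
def metricSum (q : ℂ) {A : Type*} [Ring A] [Algebra ℂ A] {N : ℕ} (x : Fin N → A) (t : ℕ) : A :=
  ∑ k : Fin N, if (k : ℕ) < t then q ^ (-twoRho k) • (x k * x k.rev) else 0

/-- The affine function `c² (1 + q²) + (q⁴ - 1) S` of the partial sums `S` of the metric relation. -/
def metricDef (q c : ℂ) {A : Type*} [Ring A] [Algebra ℂ A] {N : ℕ} (x : Fin N → A) (t : ℕ) : A :=
  algebraMap ℂ A (c ^ 2 * (1 + q ^ 2)) + (q ^ 4 - 1) • metricSum q x t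

/-- Families satisfying a reduced form of the defining relations of `Cl_q(N; c)`. -/
structure IsCliffordFamily (q c : ℂ) {A : Type*} [Ring A] [Algebra ℂ A] {N : ℕ}
    (x : Fin N → A) : Prop where
  anti : ∀ i j, i < j → i ≠ j.rev → x j * x i = (-q ^ 2) • (x i * x j)
  sq : ∀ i, i ≠ i.rev → x i * x i = 0
  mixed : ∀ i, i < i.rev →
    x i * x i.rev + x i.rev * x i = q ^ twoRho i • metricDef q c x (i : ℕ)
  mid : ∀ i, i = i.rev → (1 + q ^ 2) • (x i * x i) = metricDef q c x (i : ℕ)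

theorem metricC_eq_zero (q : ℂ) {N : ℕ} {i j : Fin N} (h : i ≠ j.rev) : metricC q i j = 0 :=
  if_neg h

theorem metricC_rev (q : ℂ) {N : ℕ} (i : Fin N) : metricC q i i.rev = q ^ (-twoRho i) := by
  simp [metricC]

theorem twoRho_rev {N : ℕ} (i : Fin N) : twoRho i.rev = -twoRho i := by
  unfold twoRho
  rcases lt_trichotomy i i.rev with h | h | h
  · simp [h, h.not_gt]
  · rw [← h]; simp [h.symm]
  · simp [h, h.not_gt]

theorem twoRho_of_lt {N : ℕ} {i : Fin N} (h : i < i.rev) :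
    twoRho i = (N : ℤ) - 2 * ((i : ℤ) + 1) := if_pos h

theorem twoRho_of_eq {N : ℕ} {i : Fin N} (h : i = i.rev) : twoRho i = 0 := by
  unfold twoRho; rw [← h]; simp

/-! ### The projector relation written out. -/

section Expand

variable {A : Type*} [Ring A] [Algebra ℂ A] {N : ℕ} (q c : ℂ) (x : Fin N → A)

theorem sum_metricC_smul (k : Fin N) :
    ∑ l, metricC q k l • (x k * x l) = q ^ (-twoRho k) • (x k * x k.rev) := by
  rw [Finset.sum_eq_single k.rev]
  · rw [metricC_rev]
  · intro l _ hl
    rw [metricC_eq_zero, zero_smul]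
    rintro rfl; simp at hl
  · simp

theorem metricSum_total : ∑ k, ∑ l, metricC q k l • (x k * x l) = metricSum q x N := by
  simp_rw [sum_metricC_smul]
  simp [metricSum]

/-- The factor `δ_{k<j}` in the braid matrix truncates the `K` term, which is how the partial sums
of the metric relation enter. -/
theorem sum_projPlus (i j : Fin N) :
    ∑ k, ∑ l, projPlus q N (k, l) (i, j) • (x k * x l) =
      (1 / (q ^ 2 + (q ^ 2)⁻¹)) • ((q ^ 2)⁻¹ • (x i * x j)
        + q ^ (2 * kron j i - 2 * kron j i.rev) • (x j * x i)
        + (q ^ 2 - (q ^ 2)⁻¹) • ((if i < j then x i * x j else 0)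
            - metricC q i j • metricSum q x j)
        - ((q + q⁻¹) * (q - q⁻¹) / (q ^ (2 * N) - 1)) • metricC q i j • metricSum q x N) := by
  have h1 : ∑ k, ∑ l, (1 : Matrix (Fin N × Fin N) (Fin N × Fin N) ℂ) (k, l) (i, j) • (x k * x l)
      = x i * x j := by
    rw [Finset.sum_eq_single i, Finset.sum_eq_single j]
    · simp
    · intro l _ hl; rw [Matrix.one_apply_ne (by simp [hl]), zero_smul]
    · simp
    · intro k _ hk
      exact Finset.sum_eq_zero fun l _ => by rw [Matrix.one_apply_ne (by simp [hk]), zero_smul]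
    · simp
  have h2 : ∑ k, ∑ l, matK q N (k, l) (i, j) • (x k * x l)
      = metricC q i j • metricSum q x N := by
    rw [← metricSum_total, Finset.smul_sum]
    refine Finset.sum_congr rfl fun k _ => ?_
    rw [Finset.smul_sum]
    refine Finset.sum_congr rfl fun l _ => ?_
    rw [smul_smul, matK, mul_comm]
  have h3 : ∑ k, ∑ l, matR q N (k, l) (i, j) • (x k * x l)
      = q ^ (2 * kron j i - 2 * kron j i.rev) • (x j * x i)
        + (q ^ 2 - (q ^ 2)⁻¹) • ((if i < j then x i * x j else 0)
            - metricC q i j • metricSum q x j) := by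
    generalize hr : q ^ 2 - (q ^ 2)⁻¹ = r
    simp only [matR, hr, add_smul, Finset.sum_add_distrib]
    congr 1
    · rw [Finset.sum_eq_single j, Finset.sum_eq_single i]
      · simp [kron]
      · intro l _ hl; simp [kron, hl]
      · simp
      · intro k _ hk
        exact Finset.sum_eq_zero fun l _ => by simp [kron, hk]
      · simp
    · simp only [mul_assoc, mul_smul _ _ (_ * _ : A), mul_sub, sub_smul]
      simp only [← Finset.smul_sum, Finset.sum_sub_distrib]
      rw [smul_sub]
      congr 2
      · rw [Finset.sum_eq_single i, Finset.sum_eq_single j]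
        · simp [kron]
        · intro l _ hl; simp [kron, hl]
        · simp
        · intro k _ hk
          exact Finset.sum_eq_zero fun l _ => by simp [kron, hk]
        · simp
      · rw [metricSum, Finset.smul_sum]
        refine Finset.sum_congr rfl fun k _ => ?_
        rw [← sum_metricC_smul]
        by_cases hk : k < j
        · have hk' : (k : ℕ) < j := hk
          simp only [hk, hk', if_true, Finset.smul_sum, matK, smul_smul]
          exact Finset.sum_congr rfl fun l _ => by rw [one_mul, mul_comm]
        · have hk' : ¬ (k : ℕ) < j := hk
          simp [hk, hk']
  calc _ = (1 / (q ^ 2 + (q ^ 2)⁻¹)) •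
        ((q ^ 2)⁻¹ • ∑ k, ∑ l,
            (1 : Matrix (Fin N × Fin N) (Fin N × Fin N) ℂ) (k, l) (i, j) • (x k * x l)
          + ∑ k, ∑ l, matR q N (k, l) (i, j) • (x k * x l)
          - ((q + q⁻¹) * (q - q⁻¹) / (q ^ (2 * N) - 1)) •
            ∑ k, ∑ l, matK q N (k, l) (i, j) • (x k * x l)) := by
        simp only [Finset.smul_sum, ← Finset.sum_add_distrib, ← Finset.sum_sub_distrib]
        refine Finset.sum_congr rfl fun k _ => Finset.sum_congr rfl fun l _ => ?_
        simp only [projPlus, Matrix.smul_apply, Matrix.sub_apply, Matrix.add_apply, smul_eq_mul]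
        module
    _ = _ := by rw [h1, h2, h3, ← add_assoc]

end Expand

/-! ### Equivalence of the defining relations with their reduced form. -/

section Relations

variable {A : Type*} [Ring A] [Algebra ℂ A] {N : ℕ} {q c : ℂ} {x : Fin N → A}

theorem metricSum_zero : metricSum q x 0 = 0 := by simp [metricSum]

theorem metricSum_succ (i : Fin N) :
    metricSum q x (i + 1) = metricSum q x i + q ^ (-twoRho i) • (x i * x i.rev) := by
  have : q ^ (-twoRho i) • (x i * x i.rev)
      = ∑ k : Fin N, if k = i then q ^ (-twoRho k) • (x k * x k.rev) else 0 := by simp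
  rw [metricSum, metricSum, this, ← Finset.sum_add_distrib]
  refine Finset.sum_congr rfl fun k _ => ?_
  rcases lt_trichotomy k i with h | h | h
  · have : (k : ℕ) < i := h
    simp [this, h.ne, this.le]
  · subst h; simp
  · have : (i : ℕ) < k := h
    rw [if_neg (by omega), if_neg (by omega), if_neg h.ne', add_zero]

theorem metricDef_succ (i : Fin N) :
    metricDef q c x (i + 1) =
      metricDef q c x i + ((q ^ 4 - 1) * q ^ (-twoRho i)) • (x i * x i.rev) := by
  rw [metricDef, metricDef, metricSum_succ]; module

theorem pow_two_add_ne_zero (hq0 : q ≠ 0) (hq : ∀ m : ℕ, 1 ≤ m → q ^ m ≠ 1) :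
    q ^ 2 + (q ^ 2)⁻¹ ≠ 0 := by
  intro h
  apply hq 8 (by norm_num)
  have : q ^ 4 = -1 := by
    field_simp at h
    linear_combination h
  linear_combination (q ^ 4 - 1) * this

theorem one_add_sq_ne_zero (hq : ∀ m : ℕ, 1 ≤ m → q ^ m ≠ 1) : 1 + q ^ 2 ≠ 0 := by
  intro h
  apply hq 4 (by norm_num)
  linear_combination (q ^ 2 - 1) * h

theorem isCliffordFamily_of_relations (hq0 : q ≠ 0) (hq : ∀ m : ℕ, 1 ≤ m → q ^ m ≠ 1)
    (hN : 1 ≤ N)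
    (hP : ∀ i j, ∑ k, ∑ l, projPlus q N (k, l) (i, j) • (x k * x l) = 0)
    (hM : ∑ k, ∑ l, metricC q k l • (x k * x l)
      = algebraMap ℂ A (c ^ 2 * ((q ^ (2 * N) - 1) / (q ^ 2 - 1)))) :
    IsCliffordFamily q c x := by
  have hs := pow_two_add_ne_zero hq0 hq
  have h2 : q ^ 2 - 1 ≠ 0 := sub_ne_zero.2 (hq 2 (by norm_num))
  have hN' : q ^ (2 * N) - 1 ≠ 0 := sub_ne_zero.2 (hq _ (by omega))
  rw [metricSum_total, Algebra.algebraMap_eq_smul_one] at hM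
  -- The metric relation turns the `K` term of the projector into a scalar, since `(q² - q⁻²)/(q² -
  -- 1) = 1 + q⁻²`.
  have key : ∀ i j, (q ^ 2)⁻¹ • (x i * x j)
        + q ^ (2 * kron j i - 2 * kron j i.rev) • (x j * x i)
        + (q ^ 2 - (q ^ 2)⁻¹) • ((if i < j then x i * x j else 0)
            - metricC q i j • metricSum q x j)
        = metricC q i j • (c ^ 2 * (1 + (q ^ 2)⁻¹)) • (1 : A) := by
    intro i j
    have h := hP i j
    rw [sum_projPlus, smul_eq_zero, or_iff_right (one_div_ne_zero hs), hM, sub_eq_zero] at h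
    rw [h]
    match_scalars
    field_simp
  constructor
  · intro i j hij hr
    have h := key i j
    have hr' : j ≠ i.rev := by rintro rfl; simp at hr
    simp only [metricC_eq_zero q hr, kron, hij.ne', hr', hij, if_true, if_false, zero_smul,
      sub_zero, mul_zero, zpow_zero, one_smul] at h
    linear_combination (norm := module) h
  · intro i hr
    have h := key i i
    simp only [metricC_eq_zero q hr, kron, hr, lt_irrefl, if_true, if_false, zero_smul,
      sub_zero, mul_zero, smul_zero, add_zero, mul_one, ← add_smul] at h
    refine (smul_eq_zero.1 h).resolve_left ?_
    rw [add_comm]; exact_mod_cast hs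
  · intro i hi
    -- In this order the indicator of `i' < i` vanishes, and the partial sum stops before the
    -- smaller index `i`.
    have h := key i.rev i
    simp only [metricC, kron, hi.ne, hi.not_gt, Fin.rev_rev, if_true, if_false, twoRho_rev,
      neg_neg, zero_sub, mul_zero, mul_one] at h
    have h' : q ^ (-2 : ℤ) = (q ^ 2)⁻¹ := by rw [zpow_neg]; norm_cast
    rw [h'] at h
    rw [metricDef, Algebra.algebraMap_eq_smul_one]
    have := congrArg (fun y => q ^ 2 • y) h
    linear_combination (norm := skip) this
    match_scalars <;> field_simp <;> ring
  · intro i hi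
    have h := key i i
    simp only [metricC, kron, ← hi, lt_irrefl, if_true, if_false, twoRho_of_eq hi,
      neg_zero, sub_self, zero_sub, mul_one, zpow_zero, one_smul] at h
    rw [metricDef, Algebra.algebraMap_eq_smul_one]
    have := congrArg (fun y => q ^ 2 • y) h
    linear_combination (norm := skip) this
    match_scalars <;> field_simp <;> ring

/-- A reflection formula, proved from the middle outwards. Passing from `e` to `e + 2` adds the
terms of the pair at position `t`, where `2ρ = e`; the `mixed` relation combines them into `(q⁴ - 1)
q^{2e} D_t`, which supplies the missing factor `q⁴`. The middle square supplies the factor `q²` when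
`e = 1`. -/
theorem IsCliffordFamily.metricDef_symm (h : IsCliffordFamily q c x) (hq0 : q ≠ 0)
    (e t : ℕ) (het : 2 * t + e = N) :
    metricDef q c x (t + e) = (q ^ 2) ^ e • metricDef q c x t := by
  induction e using Nat.twoStepInduction generalizing t with
  | zero => simp
  | one =>
    have hi : (⟨t, by omega⟩ : Fin N) = Fin.rev ⟨t, by omega⟩ := by
      ext; simp only [Fin.val_rev]; omega
    have hm := h.mid _ hi
    have hs := metricDef_succ (q := q) (c := c) (x := x) ⟨t, by omega⟩
    rw [← hi, twoRho_of_eq hi] at hs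
    simp only at hs hm
    rw [hs]
    linear_combination (norm := skip) (q ^ 2 - 1) • hm
    simp only [neg_zero, zpow_zero, pow_one]
    module
  | more e ih _ =>
    have hi : (⟨t, by omega⟩ : Fin N) < Fin.rev ⟨t, by omega⟩ := by
      rw [Fin.lt_def]; simp only [Fin.val_rev]; omega
    have hr : ((Fin.rev ⟨t, by omega⟩ : Fin N) : ℕ) = t + 1 + e := by
      simp only [Fin.val_rev]; omega
    have hm := h.mixed _ hi
    have hs := metricDef_succ (q := q) (c := c) (x := x) ⟨t, by omega⟩
    have hs' := metricDef_succ (q := q) (c := c) (x := x) (Fin.rev ⟨t, by omega⟩)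
    have hρ : q ^ twoRho (⟨t, by omega⟩ : Fin N) = q ^ e := by
      rw [twoRho_of_lt hi, ← zpow_natCast]; congr 1; simp; omega
    rw [hr, twoRho_rev, Fin.rev_rev, neg_neg, ih _ (by omega), hρ] at hs'
    rw [zpow_neg, hρ] at hs
    rw [hρ] at hm
    simp only at hs hm hs'
    rw [show t + (e + 2) = t + 1 + e + 1 by ring, hs', hs]
    linear_combination (norm := skip) ((q ^ 4 - 1) * q ^ e) • hm
    match_scalars <;> field_simp <;> ring

/-- The reflection formula with `t = 0` reads `D_N = q^{2N} D_0`, so the metric relation is a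
consequence of the reduced relations. -/
theorem IsCliffordFamily.metricSum_total (h : IsCliffordFamily q c x) (hq0 : q ≠ 0)
    (hq : ∀ m : ℕ, 1 ≤ m → q ^ m ≠ 1) :
    metricSum q x N = (c ^ 2 * ((q ^ (2 * N) - 1) / (q ^ 2 - 1))) • (1 : A) := by
  have h2 : q ^ 2 - 1 ≠ 0 := sub_ne_zero.2 (hq 2 (by norm_num))
  have h4 : q ^ 4 - 1 ≠ 0 := sub_ne_zero.2 (hq 4 (by norm_num))
  have hm := h.metricDef_symm hq0 N 0 (by omega)
  rw [zero_add, metricDef, metricDef, metricSum_zero, Algebra.algebraMap_eq_smul_one] at hm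
  refine smul_right_injective A h4 ?_
  simp only
  linear_combination (norm := skip) hm
  match_scalars
  · ring
  · field_simp
    ring

/-- The converse direction, which allows any Clifford family to receive a homomorphism from the
algebra. -/
theorem IsCliffordFamily.sum_projPlus_eq_zero (h : IsCliffordFamily q c x) (hq0 : q ≠ 0)
    (hq : ∀ m : ℕ, 1 ≤ m → q ^ m ≠ 1) (i j : Fin N) :
    ∑ k, ∑ l, projPlus q N (k, l) (i, j) • (x k * x l) = 0 := by
  have h2 : q ^ 2 - 1 ≠ 0 := sub_ne_zero.2 (hq 2 (by norm_num))
  have hN : 1 ≤ N := by have := i.2; omega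
  have hN' : q ^ (2 * N) - 1 ≠ 0 := sub_ne_zero.2 (hq _ (by omega))
  have h' : q ^ (-2 : ℤ) = (q ^ 2)⁻¹ := by rw [zpow_neg]; norm_cast
  have h'' : q ^ (2 : ℤ) = q ^ 2 := by norm_cast
  rw [sum_projPlus, h.metricSum_total hq0 hq]
  suffices key : (q ^ 2)⁻¹ • (x i * x j)
        + q ^ (2 * kron j i - 2 * kron j i.rev) • (x j * x i)
        + (q ^ 2 - (q ^ 2)⁻¹) • ((if i < j then x i * x j else 0)
            - metricC q i j • metricSum q x j)
        = metricC q i j • (c ^ 2 * (1 + (q ^ 2)⁻¹)) • (1 : A) by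
    rw [key, smul_eq_zero]
    right
    match_scalars
    field_simp
    ring
  rcases eq_or_ne i j.rev with rfl | hr
  · rcases lt_trichotomy j j.rev with hj | hj | hj
    · have hm := h.mixed j hj
      rw [metricDef, Algebra.algebraMap_eq_smul_one] at hm
      simp only [metricC, kron, hj.ne, hj.not_gt, Fin.rev_rev, if_true, if_false, twoRho_rev,
        neg_neg, zero_sub, mul_zero, mul_one, h']
      linear_combination (norm := skip) (q ^ 2)⁻¹ • hm
      match_scalars <;> field_simp <;> ring
    · have hm := h.mid j hj
      rw [metricDef, Algebra.algebraMap_eq_smul_one] at hm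
      simp only [metricC, kron, ← hj, lt_irrefl, if_true, if_false, twoRho_of_eq hj,
        neg_zero, sub_self, zero_sub, mul_one, zpow_zero, one_smul]
      linear_combination (norm := skip) (q ^ 2)⁻¹ • hm
      match_scalars <;> field_simp <;> ring
    · obtain ⟨a, rfl⟩ : ∃ a : Fin N, j = a.rev := ⟨j.rev, (Fin.rev_rev j).symm⟩
      rw [Fin.rev_rev] at hj ⊢
      have hm := h.mixed a hj
      have hρ := twoRho_of_lt hj
      have hlt := Fin.lt_def.1 hj
      rw [Fin.val_rev] at hlt
      -- The relation for `(a, a')` contains the partial sum up to `a'`. Reflection replaces it by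
      -- the one up to `a + 1`, that is by `D_a` and the single product `x_a x_{a'}`, and then
      -- `mixed` applies.
      have hs := h.metricDef_symm hq0 (N - 2 * (a + 1)) (a + 1) (by omega)
      have hs' := metricDef_succ (q := q) (c := c) (x := x) a
      have hr : (a : ℕ) + 1 + (N - 2 * (a + 1)) = a.rev := by rw [Fin.val_rev]; omega
      have hz : (q ^ 2) ^ (N - 2 * ((a : ℕ) + 1)) = (q ^ twoRho a) ^ 2 := by
        rw [hρ, ← pow_mul, mul_comm, pow_mul]
        congr 1
        rw [← zpow_natCast]
        congr 1
        push_cast [show 2 * ((a : ℕ) + 1) ≤ N by omega]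
        ring
      rw [hr, hs', hz] at hs
      have he : q ^ twoRho a ≠ 0 := zpow_ne_zero _ hq0
      simp only [metricC, kron, hj.ne', hj, Fin.rev_rev, if_true, if_false,
        zero_sub, mul_zero, mul_one, h', zpow_neg] at hs ⊢
      generalize q ^ twoRho a = e at *
      generalize hX : metricSum q x (a.rev : ℕ) = S at *
      rw [metricDef, metricDef, hX, Algebra.algebraMap_eq_smul_one] at hs
      rw [metricDef, Algebra.algebraMap_eq_smul_one] at hm
      linear_combination (norm := skip) (-(e⁻¹ * (q ^ 2)⁻¹)) • hs + (q ^ 2)⁻¹ • hm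
      match_scalars <;> field_simp <;> ring
  · have hr' : j ≠ i.rev := by rintro rfl; simp at hr
    rw [metricC_eq_zero q hr]
    rcases lt_trichotomy i j with hij | rfl | hij
    · simp only [kron, hij.ne', hr', hij, if_true, if_false, zero_smul,
        sub_zero, mul_zero, zpow_zero, one_smul, h.anti i j hij hr]
      module
    · simp [h.sq i hr]
    · simp only [kron, hij.ne, hr', hij.not_gt, if_false, zero_smul,
        sub_zero, mul_zero, zpow_zero, one_smul, h.anti j i hij hr']
      match_scalars
      field_simp
      ring

end Relations

/-! ### Splitting off the outer pair. -/

section Peel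

variable {A : Type*} [Ring A] [Algebra ℂ A] {N : ℕ} {q c : ℂ} {x : Fin (N + 2) → A}

/-- The idempotent attached to the first and the last element of a Clifford family. -/
def outerIdem (q c : ℂ) (x : Fin (N + 2) → A) : A :=
  (c ^ 2 * (1 + q ^ 2) * q ^ N)⁻¹ • (x 0 * x (Fin.last (N + 1)))

/-- The element `r^p`, where `p` is the idempotent of the outer pair. -/
def outerPow (q c : ℂ) (x : Fin (N + 2) → A) (r : ℂ) : A :=
  1 + (r - 1) • outerIdem q c x

/-- The inner elements of a Clifford family, rescaled so as to commute with the outer pair. -/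
def inner (q c : ℂ) (x : Fin (N + 2) → A) (i : Fin N) : A :=
  x i.succ.castSucc * outerPow q c x (-(q ^ 2)⁻¹)

theorem twoRho_zero : twoRho (0 : Fin (N + 2)) = N := by
  rw [twoRho_of_lt (by simp [Fin.lt_def])]; simp

theorem rev_succ_castSucc (i : Fin N) : i.succ.castSucc.rev = i.rev.succ.castSucc := by
  rw [Fin.rev_castSucc, Fin.rev_succ, Fin.succ_castSucc]

/-- Removing the outer pair lowers the length by two and the index by one, and these changes cancel
in `ρ`. -/
theorem twoRho_succ_castSucc (i : Fin N) : twoRho i.succ.castSucc = twoRho i := by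
  simp only [twoRho, rev_succ_castSucc, Fin.castSucc_lt_castSucc_iff, Fin.succ_lt_succ_iff]
  simp only [Fin.val_castSucc, Fin.val_succ]
  push_cast
  split_ifs <;> ring

theorem succ_castSucc_ne_rev {i j : Fin N} (h : i ≠ j.rev) :
    i.succ.castSucc ≠ j.succ.castSucc.rev := by
  rw [rev_succ_castSucc]; simpa using h

theorem metricDef_zero : metricDef q c x 0 = (c ^ 2 * (1 + q ^ 2)) • (1 : A) := by
  rw [metricDef, metricSum_zero, smul_zero, add_zero, Algebra.algebraMap_eq_smul_one]

namespace IsCliffordFamily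

variable (h : IsCliffordFamily q c x) (hq0 : q ≠ 0) (hD : c ^ 2 * (1 + q ^ 2) ≠ 0)

include h

theorem zero_mul_last_add :
    x 0 * x (Fin.last _) + x (Fin.last _) * x 0 = (c ^ 2 * (1 + q ^ 2) * q ^ N) • (1 : A) := by
  have := h.mixed 0 (by simp [Fin.lt_def])
  rw [Fin.rev_zero, twoRho_zero, Fin.val_zero, metricDef_zero, zpow_natCast, smul_smul] at this
  rw [this, mul_comm]

theorem zero_mul_zero : x 0 * x 0 = 0 := h.sq 0 (by simp [Fin.ext_iff])

theorem last_mul_last : x (Fin.last _) * x (Fin.last _) = 0 :=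
  h.sq (Fin.last _) (by simp [Fin.ext_iff])

theorem succ_mul_zero (i : Fin N) :
    x i.succ.castSucc * x 0 = (-q ^ 2) • (x 0 * x i.succ.castSucc) :=
  h.anti 0 _ (by simp [Fin.lt_def]) (by rw [rev_succ_castSucc]; simp [Fin.ext_iff])

theorem last_mul_succ (i : Fin N) :
    x (Fin.last _) * x i.succ.castSucc = (-q ^ 2) • (x i.succ.castSucc * x (Fin.last _)) :=
  h.anti _ _ (by simp [Fin.lt_def]) (by rw [Fin.rev_last]; simp [Fin.ext_iff])

theorem zero_mul_outerIdem : x 0 * outerIdem q c x = 0 := by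
  rw [outerIdem, mul_smul_comm, ← mul_assoc, h.zero_mul_zero, zero_mul, smul_zero]

theorem outerIdem_mul_last : outerIdem q c x * x (Fin.last _) = 0 := by
  rw [outerIdem, smul_mul_assoc, mul_assoc (x 0), h.last_mul_last, mul_zero, smul_zero]

/-- Moving `x_i` past the last generator gives a factor `-q²`, which is absorbed when it is moved
past the first one. -/
theorem outerIdem_comm_succ (i : Fin N) : Commute (outerIdem q c x) (x i.succ.castSucc) := by
  refine Commute.smul_left ?_ _
  rw [Commute, SemiconjBy, mul_assoc, h.last_mul_succ, ← mul_assoc, h.succ_mul_zero, mul_smul_comm,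
    smul_mul_assoc, mul_assoc]

include hq0 hD

theorem outerIdem_mul_zero : outerIdem q c x * x 0 = x 0 := by
  have hne : c ^ 2 * (1 + q ^ 2) * q ^ N ≠ 0 := mul_ne_zero hD (pow_ne_zero _ hq0)
  have := congrArg (x 0 * ·) h.zero_mul_last_add
  rw [outerIdem]
  generalize c ^ 2 * (1 + q ^ 2) * q ^ N = d at *
  simp only [mul_add, ← mul_assoc, h.zero_mul_zero, zero_mul, zero_add, mul_smul_comm,
    mul_one] at this
  rw [smul_mul_assoc, this, smul_smul, inv_mul_cancel₀ hne, one_smul]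

theorem last_mul_outerIdem : x (Fin.last _) * outerIdem q c x = x (Fin.last _) := by
  have hne : c ^ 2 * (1 + q ^ 2) * q ^ N ≠ 0 := mul_ne_zero hD (pow_ne_zero _ hq0)
  have := congrArg (· * x (Fin.last _)) h.zero_mul_last_add
  rw [outerIdem]
  generalize c ^ 2 * (1 + q ^ 2) * q ^ N = d at *
  simp only [add_mul, mul_assoc, h.last_mul_last, mul_zero, zero_add, smul_mul_assoc,
    one_mul] at this
  rw [mul_smul_comm, this, smul_smul, inv_mul_cancel₀ hne, one_smul]

theorem outerIdem_mul_self : outerIdem q c x * outerIdem q c x = outerIdem q c x := by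
  conv_lhs => rw [outerIdem, mul_smul_comm, ← outerIdem, ← mul_assoc,
    h.outerIdem_mul_zero hq0 hD]
  rfl

omit hq0 hD in
theorem outerPow_comm_succ (r : ℂ) (i : Fin N) :
    Commute (outerPow q c x r) (x i.succ.castSucc) :=
  (Commute.one_left _).add_left ((h.outerIdem_comm_succ i).smul_left _)

theorem outerPow_mul (r s : ℂ) : outerPow q c x r * outerPow q c x s = outerPow q c x (r * s) := by
  simp only [outerPow, mul_add, add_mul, mul_smul_comm, smul_mul_assoc, mul_one, one_mul,
    h.outerIdem_mul_self hq0 hD]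
  module

omit hq0 hD in
theorem zero_mul_outerPow (r : ℂ) : x 0 * outerPow q c x r = x 0 := by
  rw [outerPow, mul_add, mul_smul_comm, h.zero_mul_outerIdem, smul_zero, add_zero, mul_one]

omit hq0 hD in
theorem outerPow_mul_last (r : ℂ) : outerPow q c x r * x (Fin.last _) = x (Fin.last _) := by
  rw [outerPow, add_mul, smul_mul_assoc, h.outerIdem_mul_last, smul_zero, add_zero, one_mul]

theorem outerPow_mul_zero (r : ℂ) : outerPow q c x r * x 0 = r • x 0 := by
  rw [outerPow, add_mul, smul_mul_assoc, h.outerIdem_mul_zero hq0 hD, one_mul]; module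

theorem last_mul_outerPow (r : ℂ) : x (Fin.last _) * outerPow q c x r = r • x (Fin.last _) := by
  rw [outerPow, mul_add, mul_smul_comm, h.last_mul_outerIdem hq0 hD, mul_one]; module

/-- The factor `-q²` from exchanging the generators cancels against the `-q⁻²` from `r^p u = r u`,
`u r^p = u` with `r = -q⁻²`. -/
theorem inner_comm_zero (i : Fin N) : Commute (inner q c x i) (x 0) := by
  rw [Commute, SemiconjBy, inner, mul_assoc, h.outerPow_mul_zero hq0 hD, mul_smul_comm,
    h.succ_mul_zero, smul_smul, ← (h.outerPow_comm_succ _ i).eq, ← mul_assoc, h.zero_mul_outerPow]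
  rw [neg_mul_neg, inv_mul_cancel₀ (pow_ne_zero _ hq0), one_smul]

theorem inner_comm_last (i : Fin N) : Commute (inner q c x i) (x (Fin.last _)) := by
  rw [Commute, SemiconjBy, inner, mul_assoc, h.outerPow_mul_last, ← (h.outerPow_comm_succ _ i).eq,
    ← mul_assoc, h.last_mul_outerPow hq0 hD, smul_mul_assoc, h.last_mul_succ, smul_smul]
  rw [neg_mul_neg, inv_mul_cancel₀ (pow_ne_zero _ hq0), one_smul]

theorem inner_comm_outerIdem (i : Fin N) : Commute (inner q c x i) (outerIdem q c x) :=
  ((h.inner_comm_zero hq0 hD i).mul_right (h.inner_comm_last hq0 hD i)).smul_right _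

theorem inner_comm_outerPow (i : Fin N) (r : ℂ) : Commute (inner q c x i) (outerPow q c x r) :=
  (Commute.one_right _).add_right ((h.inner_comm_outerIdem hq0 hD i).smul_right _)

omit h hq0 hD in
theorem _root_.FRTClifford.outerPow_one : outerPow q c x 1 = 1 := by simp [outerPow]

theorem succ_eq_inner_mul (i : Fin N) :
    x i.succ.castSucc = inner q c x i * outerPow q c x (-q ^ 2) := by
  rw [inner, mul_assoc, h.outerPow_mul hq0 hD, neg_mul_neg, inv_mul_cancel₀ (pow_ne_zero _ hq0),
    outerPow_one, mul_one]

theorem succ_mul_succ (i j : Fin N) :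
    x i.succ.castSucc * x j.succ.castSucc
      = inner q c x i * inner q c x j * outerPow q c x (q ^ 4) := by
  rw [h.succ_eq_inner_mul hq0 hD i, h.succ_eq_inner_mul hq0 hD j, mul_assoc,
    ← mul_assoc (outerPow q c x _) (inner q c x j), ← (h.inner_comm_outerPow hq0 hD j _).eq,
    mul_assoc (inner q c x j), h.outerPow_mul hq0 hD, mul_assoc]
  congr 3; ring

theorem inner_mul_inner (i j : Fin N) :
    inner q c x i * inner q c x j =
      x i.succ.castSucc * x j.succ.castSucc * outerPow q c x (q ^ 4)⁻¹ := by
  rw [h.succ_mul_succ hq0 hD, mul_assoc, h.outerPow_mul hq0 hD,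
    mul_inv_cancel₀ (pow_ne_zero _ hq0), outerPow_one, mul_one]

theorem metricSum_inner (t : ℕ) (ht : t ≤ N) :
    metricSum q x (t + 1) = (c ^ 2 * (1 + q ^ 2)) • outerIdem q c x
      + metricSum q (inner q c x) t * outerPow q c x (q ^ 4) := by
  rw [metricSum, Fin.sum_univ_castSucc, Fin.sum_univ_succ, metricSum, Finset.sum_mul]
  have hlast : ¬ (N + 1 < t + 1) := by omega
  simp only [Fin.val_last, hlast, if_false, add_zero, Fin.castSucc_zero, Fin.val_zero,
    if_true, Fin.rev_zero, twoRho_zero, zero_lt_iff, ne_eq, Nat.add_eq_zero_iff,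
    one_ne_zero, and_false, not_false_iff]
  congr 1
  · rw [outerIdem, smul_smul]
    congr 1
    rw [zpow_neg, zpow_natCast, mul_inv, ← mul_assoc, mul_inv_cancel₀ hD, one_mul]
  · refine Finset.sum_congr rfl fun k _ => ?_
    rw [rev_succ_castSucc, twoRho_succ_castSucc, h.succ_mul_succ hq0 hD]
    simp only [Fin.val_castSucc, Fin.val_succ, Nat.add_lt_add_iff_right, ite_mul, zero_mul,
      smul_mul_assoc]

/-- The outer term contributes `c²(1 + q²) p` to the sum, and `1 + (q⁴ - 1)p = q^{4p}`. Thus the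
constant term also acquires the factor `q^{4p}`, and the constant `c` survives the peeling
unchanged. -/
theorem metricDef_inner (t : ℕ) (ht : t ≤ N) :
    metricDef q c x (t + 1) = metricDef q c (inner q c x) t * outerPow q c x (q ^ 4) := by
  rw [metricDef, h.metricSum_inner hq0 hD t ht, metricDef, add_mul, smul_mul_assoc,
    Algebra.algebraMap_eq_smul_one, smul_mul_assoc, one_mul]
  conv_rhs => lhs; rw [outerPow]
  module

/-- All relations are quadratic, and both sides of each acquire the same invertible factor `q^{4p}`,
which cancels. -/
protected theorem inner : IsCliffordFamily q c (inner q c x) := by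
  have hq4 : q ^ 4 * (q ^ 4)⁻¹ = 1 := mul_inv_cancel₀ (pow_ne_zero _ hq0)
  constructor
  · intro i j hij hr
    rw [h.inner_mul_inner hq0 hD, h.inner_mul_inner hq0 hD,
      h.anti i.succ.castSucc j.succ.castSucc (by simpa using hij) (succ_castSucc_ne_rev hr),
      smul_mul_assoc]
  · intro i hr
    rw [h.inner_mul_inner hq0 hD, h.sq _ (succ_castSucc_ne_rev hr), zero_mul]
  · intro i hi
    have := h.mixed i.succ.castSucc (by rw [rev_succ_castSucc]; simpa using hi)
    rw [rev_succ_castSucc, twoRho_succ_castSucc, Fin.val_castSucc, Fin.val_succ,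
      h.metricDef_inner hq0 hD _ i.2.le] at this
    rw [h.inner_mul_inner hq0 hD, h.inner_mul_inner hq0 hD, ← add_mul, this, smul_mul_assoc,
      mul_assoc, h.outerPow_mul hq0 hD, hq4, outerPow_one, mul_one]
  · intro i hi
    have := h.mid i.succ.castSucc (by rw [rev_succ_castSucc]; simpa using hi)
    rw [Fin.val_castSucc, Fin.val_succ, h.metricDef_inner hq0 hD _ i.2.le] at this
    rw [h.inner_mul_inner hq0 hD, ← smul_mul_assoc, this,
      mul_assoc, h.outerPow_mul hq0 hD, hq4, outerPow_one, mul_one]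

end IsCliffordFamily

end Peel

/-! ### The commutant of a fermionic pair. -/

section MatrixUnits

variable {A : Type*} [Ring A] [Algebra ℂ A]

/-- In an algebra generated by a subalgebra `B` and a fermionic pair commuting with `B`, the
commutant of the pair is `B`. -/
theorem mem_of_commute_pair {B : Subalgebra ℂ A} {u w z : A} {d : ℂ} (hd : d ≠ 0)
    (huu : u * u = 0) (hww : w * w = 0) (huw : u * w + w * u = d • (1 : A))
    (hu : ∀ b ∈ B, Commute b u) (hw : ∀ b ∈ B, Commute b w)
    (hz : z ∈ Algebra.adjoin ℂ ((B : Set A) ∪ {u, w})) (hzu : Commute z u) (hzw : Commute z w) :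
    z ∈ B := by
  have hwu : w * u = d • (1 : A) - u * w := eq_sub_of_add_eq' huw
  have hwuw : w * (u * w) = d • w := by
    rw [← mul_assoc, hwu, sub_mul, mul_assoc, hww, mul_zero, sub_zero, smul_mul_assoc, one_mul]
  have huwu : u * (w * u) = d • u := by
    rw [hwu, mul_sub, ← mul_assoc, huu, zero_mul, sub_zero, mul_smul_comm, mul_one]
  -- The normal form `B + Bu + Bw + Buw` is stable under left multiplication by the algebra.
  -- Quantifying over `y` makes the product case a mere composition; `y = 1` gives the normal form
  -- of `z`.
  have span : ∀ a ∈ Algebra.adjoin ℂ ((B : Set A) ∪ {u, w}),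
      ∀ y, (∃ b₀ ∈ B, ∃ b₁ ∈ B, ∃ b₂ ∈ B, ∃ b₃ ∈ B,
          y = b₀ + b₁ * u + b₂ * w + b₃ * (u * w)) →
        ∃ b₀ ∈ B, ∃ b₁ ∈ B, ∃ b₂ ∈ B, ∃ b₃ ∈ B,
          a * y = b₀ + b₁ * u + b₂ * w + b₃ * (u * w) := by
    intro a ha
    induction ha using Algebra.adjoin_induction with
    | mem a ha =>
      rintro _ ⟨b₀, h₀, b₁, h₁, b₂, h₂, b₃, h₃, rfl⟩
      rcases ha with ha | rfl | rfl
      · refine ⟨a * b₀, B.mul_mem ha h₀, a * b₁, B.mul_mem ha h₁, a * b₂, B.mul_mem ha h₂,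
          a * b₃, B.mul_mem ha h₃, ?_⟩
        simp only [mul_add, mul_assoc]
      · refine ⟨0, B.zero_mem, b₀, h₀, 0, B.zero_mem, b₂, h₂, ?_⟩
        simp only [mul_add, ← mul_assoc, ← (hu _ h₀).eq, ← (hu _ h₁).eq, ← (hu _ h₂).eq,
          ← (hu _ h₃).eq]
        simp only [mul_assoc _ a a, huu, mul_zero, zero_mul, add_zero, zero_add]
      · refine ⟨d • b₁, B.smul_mem h₁ d, 0, B.zero_mem, b₀ + d • b₃,
          B.add_mem h₀ (B.smul_mem h₃ d), -b₁, B.neg_mem h₁, ?_⟩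
        simp only [mul_add, ← mul_assoc, ← (hw _ h₀).eq, ← (hw _ h₁).eq, ← (hw _ h₂).eq,
          ← (hw _ h₃).eq]
        simp only [mul_assoc, hwuw]
        simp only [hwu, hww, mul_sub, mul_smul_comm, mul_one, mul_zero, zero_mul,
          add_mul, smul_mul_assoc, neg_mul]
        abel
    | algebraMap r =>
      rintro _ ⟨b₀, h₀, b₁, h₁, b₂, h₂, b₃, h₃, rfl⟩
      refine ⟨r • b₀, B.smul_mem h₀ r, r • b₁, B.smul_mem h₁ r, r • b₂, B.smul_mem h₂ r,
        r • b₃, B.smul_mem h₃ r, ?_⟩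
      simp only [Algebra.algebraMap_eq_smul_one, smul_mul_assoc, one_mul, smul_add]
    | add a a' _ _ ih ih' =>
      intro y hy
      obtain ⟨b₀, h₀, b₁, h₁, b₂, h₂, b₃, h₃, e⟩ := ih y hy
      obtain ⟨b₀', h₀', b₁', h₁', b₂', h₂', b₃', h₃', e'⟩ := ih' y hy
      refine ⟨b₀ + b₀', B.add_mem h₀ h₀', b₁ + b₁', B.add_mem h₁ h₁', b₂ + b₂',
        B.add_mem h₂ h₂', b₃ + b₃', B.add_mem h₃ h₃', ?_⟩
      rw [add_mul, e, e']
      simp only [add_mul]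
      abel
    | mul a a' _ _ ih ih' =>
      intro y hy
      rw [mul_assoc]
      exact ih _ (ih' y hy)
  obtain ⟨b₀, h₀, b₁, h₁, b₂, h₂, b₃, h₃, e⟩ := span z hz 1
    ⟨1, B.one_mem, 0, B.zero_mem, 0, B.zero_mem, 0, B.zero_mem, by simp⟩
  rw [mul_one] at e
  -- If `bu = 0` then `b(uw + wu) = 0`, because `b` commutes with `w`; hence `d b = 0`.
  have hb : ∀ b ∈ B, b * u = 0 → b = 0 := by
    intro b hbB hbu
    have h1 : b * (u * w + w * u) = 0 := by
      rw [mul_add, ← mul_assoc, hbu, zero_mul, zero_add, ← mul_assoc, (hw b hbB).eq, mul_assoc,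
        hbu, mul_zero]
    rw [huw, mul_smul_comm, mul_one] at h1
    exact (smul_eq_zero.1 h1).resolve_left hd
  -- This is `zu = uz` in normal form. Multiplying by `u` on the right isolates `d b₂ u`, and then
  -- `b₃ u` remains.
  have e₁ : b₂ * (w * u) + d • (b₃ * u) = b₂ * (u * w) := by
    have h1 := hzu.eq
    rw [e] at h1
    simp only [mul_add, ← mul_assoc, ← (hu _ h₀).eq, ← (hu _ h₁).eq, ← (hu _ h₂).eq,
      ← (hu _ h₃).eq] at h1
    simp only [add_mul, mul_assoc, huwu, huu, mul_zero, zero_mul, add_zero, zero_add,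
      mul_smul_comm, add_assoc] at h1
    exact add_left_cancel h1
  have z₂ : b₂ = 0 := by
    refine hb _ h₂ ?_
    have h1 := congrArg (· * u) e₁
    simp only [add_mul, mul_assoc, huu, huwu, mul_zero, zero_add, smul_mul_assoc, smul_zero,
      mul_smul_comm] at h1
    exact (smul_eq_zero.1 h1.symm).resolve_left hd
  have z₃ : b₃ = 0 := by
    refine hb _ h₃ ?_
    rw [z₂, zero_mul, zero_mul, zero_add] at e₁
    exact (smul_eq_zero.1 e₁).resolve_left hd
  have z₁ : b₁ = 0 := by
    refine hb _ h₁ ?_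
    have h1 := hzw.eq
    rw [e, z₂, z₃] at h1
    simp only [zero_mul, add_zero, add_mul, mul_add, ← mul_assoc, ← (hw _ h₀).eq,
      ← (hw _ h₁).eq] at h1
    have h2 := congrArg (· * u) (add_left_cancel h1)
    simp only [mul_assoc, huwu, huu, mul_zero, mul_smul_comm] at h2
    exact (smul_eq_zero.1 h2).resolve_left hd
  rw [e, z₁, z₂, z₃]
  simpa using h₀

end MatrixUnits

/-! ### Central elements descend to the inner family. -/

section Center

variable {A : Type*} [Ring A] [Algebra ℂ A] {N : ℕ} {q c : ℂ} {x : Fin (N + 2) → A}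

namespace IsCliffordFamily

variable (h : IsCliffordFamily q c x) (hq0 : q ≠ 0) (hD : c ^ 2 * (1 + q ^ 2) ≠ 0)

include h hq0 hD

theorem adjoin_inner_comm_zero {b : A} (hb : b ∈ Algebra.adjoin ℂ (Set.range (inner q c x))) :
    Commute b (x 0) := by
  have : Algebra.adjoin ℂ (Set.range (inner q c x)) ≤ Subalgebra.centralizer ℂ {x 0} := by
    rw [Algebra.adjoin_le_iff]
    rintro _ ⟨i, rfl⟩
    rw [SetLike.mem_coe, Subalgebra.mem_centralizer_iff]
    rintro _ rfl
    exact (h.inner_comm_zero hq0 hD i).symm.eq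
  exact (Subalgebra.mem_centralizer_iff ℂ |>.1 (this hb) _ rfl).symm

theorem adjoin_inner_comm_last {b : A} (hb : b ∈ Algebra.adjoin ℂ (Set.range (inner q c x))) :
    Commute b (x (Fin.last _)) := by
  have : Algebra.adjoin ℂ (Set.range (inner q c x)) ≤
      Subalgebra.centralizer ℂ {x (Fin.last _)} := by
    rw [Algebra.adjoin_le_iff]
    rintro _ ⟨i, rfl⟩
    rw [SetLike.mem_coe, Subalgebra.mem_centralizer_iff]
    rintro _ rfl
    exact (h.inner_comm_last hq0 hD i).symm.eq
  exact (Subalgebra.mem_centralizer_iff ℂ |>.1 (this hb) _ rfl).symm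

theorem adjoin_inner_comm_outerPow {b : A}
    (hb : b ∈ Algebra.adjoin ℂ (Set.range (inner q c x))) (r : ℂ) :
    Commute b (outerPow q c x r) :=
  (Commute.one_right _).add_right ((((h.adjoin_inner_comm_zero hq0 hD hb).mul_right
    (h.adjoin_inner_comm_last hq0 hD hb)).smul_right _).smul_right _)

omit h hq0 hD in
theorem _root_.FRTClifford.outerPow_mem {S : Subalgebra ℂ A} (h0 : x 0 ∈ S)
    (hl : x (Fin.last _) ∈ S) (r : ℂ) : outerPow q c x r ∈ S :=
  S.add_mem S.one_mem (S.smul_mem (S.smul_mem (S.mul_mem h0 hl) _) _)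

theorem mem_adjoin_inner {z : A} (hz : z ∈ Algebra.adjoin ℂ (Set.range x))
    (hc : ∀ i, Commute z (x i)) : z ∈ Algebra.adjoin ℂ (Set.range (inner q c x)) := by
  refine mem_of_commute_pair (mul_ne_zero hD (pow_ne_zero N hq0)) h.zero_mul_zero h.last_mul_last
    h.zero_mul_last_add (fun b hb => h.adjoin_inner_comm_zero hq0 hD hb)
    (fun b hb => h.adjoin_inner_comm_last hq0 hD hb) ?_ (hc _) (hc _)
  refine (Algebra.adjoin_le_iff.2 ?_ :
    Algebra.adjoin ℂ (Set.range x) ≤ Algebra.adjoin ℂ _) hz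
  have h0 : x 0 ∈ Algebra.adjoin ℂ
      ((Algebra.adjoin ℂ (Set.range (inner q c x)) : Set A) ∪ {x 0, x (Fin.last _)}) :=
    Algebra.subset_adjoin (by simp)
  have hl : x (Fin.last _) ∈ Algebra.adjoin ℂ
      ((Algebra.adjoin ℂ (Set.range (inner q c x)) : Set A) ∪ {x 0, x (Fin.last _)}) :=
    Algebra.subset_adjoin (by simp)
  rintro _ ⟨i, rfl⟩
  induction i using Fin.lastCases with
  | last => exact hl
  | cast i =>
    induction i using Fin.cases with
    | zero => exact h0
    | succ i =>
      rw [h.succ_eq_inner_mul hq0 hD]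
      exact Subalgebra.mul_mem _
        (Algebra.subset_adjoin (Or.inl (Algebra.subset_adjoin ⟨i, rfl⟩))) (outerPow_mem h0 hl _)

omit h hq0 hD in
theorem _root_.FRTClifford.commute_inner {z : A} (hc : ∀ i, Commute z (x i)) (i : Fin N) :
    Commute z (inner q c x i) :=
  (hc _).mul_right ((Commute.one_right _).add_right
    ((((hc _).mul_right (hc _)).smul_right _).smul_right _))

end IsCliffordFamily

/-- A property of elements of a Clifford family holds for all of them if it holds for the outer
pair and for the middle ones. -/
theorem forall_fin_add_two {N : ℕ} {P : Fin (N + 2) → Prop} (h0 : P 0) (hl : P (Fin.last _))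
    (hs : ∀ i : Fin N, P i.succ.castSucc) (i : Fin (N + 2)) : P i := by
  induction i using Fin.lastCases with
  | last => exact hl
  | cast i =>
    induction i using Fin.cases with
    | zero => exact h0
    | succ i => exact hs i

end Center

/-! ### Nested products and their behaviour under peeling and rescaling. -/

section Nested

variable {A : Type*} [Ring A]

/-- The nested product `x_1^{j_1} ⋯ x_n^{j_n} μ x_{n'}^{j_n} ⋯ x_{1'}^{j_1}`. -/
def nested {n N : ℕ} (h : n ≤ N) (x : Fin N → A) (μ : A) (J : Fin n → Fin 2) : A :=
  ((List.finRange n).map fun i => x (Fin.castLE h i) ^ (J i : ℕ)).prod * μ *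
    ((List.finRange n).reverse.map fun i => x (Fin.castLE h i).rev ^ (J i : ℕ)).prod

/-- The weighted sum of nested products occurring in `z0` and `z1`. -/
def nestedSum [Algebra ℂ A] (q : ℂ) (a : ℕ → ℂ) {n N : ℕ} (h : n ≤ N) (x : Fin N → A) (μ : A) : A :=
  ∑ J : Fin n → Fin 2,
    (a (ell J) * q ^ (2 * (bigL J : ℤ) - (ell J : ℤ) * (2 * (n : ℤ) - (ell J : ℤ) + 1))) •
      nested h x μ J

theorem ell_cons {n : ℕ} (j : Fin 2) (J : Fin n → Fin 2) :
    ell (Fin.cons j J : Fin (n + 1) → Fin 2) = j + ell J := by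
  simp [ell, Fin.sum_univ_succ]

theorem bigL_cons {n : ℕ} (j : Fin 2) (J : Fin n → Fin 2) :
    bigL (Fin.cons j J : Fin (n + 1) → Fin 2) = j + ell J + bigL J := by
  simp [bigL, ell, Fin.sum_univ_succ, add_mul, Finset.sum_add_distrib, add_comm, add_left_comm]

theorem ell_le {n : ℕ} (J : Fin n → Fin 2) : ell J ≤ n := by
  calc ell J ≤ ∑ _i : Fin n, 1 := Finset.sum_le_sum fun i _ => by omega
    _ = n := by simp

theorem nested_cons {n N : ℕ} (h : n ≤ N) (h' : n + 1 ≤ N + 2) (x : Fin (N + 2) → A) (μ : A)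
    (j : Fin 2) (J : Fin n → Fin 2) :
    nested h' x μ (Fin.cons j J : Fin (n + 1) → Fin 2) =
      x 0 ^ (j : ℕ) * nested h (fun i => x i.succ.castSucc) μ J * x (Fin.last _) ^ (j : ℕ) := by
  have hs : ∀ i : Fin n, Fin.castLE h' i.succ = (Fin.castLE h i).succ.castSucc := fun i => by
    ext; simp
  have h0 : Fin.castLE h' 0 = 0 := by ext; simp
  simp only [nested, List.finRange_succ, List.map_cons, List.prod_cons, List.map_map,
    List.reverse_cons, List.map_append, List.prod_append, List.map_reverse, Function.comp_def,
    Fin.cons_zero, Fin.cons_succ, hs, h0, rev_succ_castSucc, Fin.rev_zero, List.map_nil,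
    List.prod_nil, mul_one, mul_assoc]

theorem prod_map_mul_pow {ι : Type*} (L : List ι) (y : ι → A) (e : ι → ℕ) (g : A)
    (hg : ∀ i, Commute (y i) g) :
    (L.map fun i => (y i * g) ^ e i).prod
      = (L.map fun i => y i ^ e i).prod * g ^ (L.map e).sum := by
  induction L with
  | nil => simp
  | cons i L ih =>
    have hc : Commute (L.map fun i => y i ^ e i).prod g :=
      Commute.list_prod_left _ _ fun z hz => by
        obtain ⟨k, -, rfl⟩ := List.mem_map.1 hz
        exact (hg k).pow_left _
    simp only [List.map_cons, List.prod_cons, List.sum_cons, ih, (hg i).mul_pow, pow_add]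
    rw [mul_assoc, ← mul_assoc (g ^ e i), ← (hc.pow_right (e i)).eq]
    simp only [mul_assoc]

theorem nested_commute {n N : ℕ} (h : n ≤ N) (x : Fin N → A) (μ : A) (J : Fin n → Fin 2) {g : A}
    (hx : ∀ i, Commute (x i) g) (hμ : Commute μ g) : Commute (nested h x μ J) g := by
  refine ((Commute.list_prod_left _ _ ?_).mul_left hμ).mul_left (Commute.list_prod_left _ _ ?_)
  all_goals
    intro z hz
    obtain ⟨k, -, rfl⟩ := List.mem_map.1 hz
    exact (hx _).pow_left _

/-- Each of the `ℓ(J)` factors on the left and on the right of `μ` carries one `g`. With `g =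
(-q²)^p` this produces the power `q^{4ℓ(J)}` in the recursion. -/
theorem nested_mul {n N : ℕ} (h : n ≤ N) (y : Fin N → A) (μ m g : A) (J : Fin n → Fin 2)
    (hy : ∀ i, Commute (y i) g) (hμ : Commute μ g) (hm : ∀ i, Commute (y i) m)
    (hgm : Commute g m) :
    nested h (fun i => y i * g) (μ * m) J = nested h y μ J * (m * g ^ (2 * ell J)) := by
  have hsum : ((List.finRange n).map fun i => (J i : ℕ)).sum = ell J := by
    rw [ell, ← List.sum_ofFn, List.ofFn_eq_map]
  have hc : ∀ {g' : A}, (∀ i, Commute (y i) g') → Commute ((List.finRange n).reverse.map fun i =>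
      y (Fin.castLE h i).rev ^ (J i : ℕ)).prod g' := fun hg' =>
    Commute.list_prod_left _ _ fun z hz => by
      obtain ⟨k, -, rfl⟩ := List.mem_map.1 hz
      exact (hg' _).pow_left _
  rw [nested, prod_map_mul_pow (List.finRange n) (fun i => y (Fin.castLE h i)) (fun i => (J i : ℕ))
    g (fun i => hy _), prod_map_mul_pow (List.finRange n).reverse
    (fun i => y (Fin.castLE h i).rev) (fun i => (J i : ℕ)) g (fun i => hy _), nested]
  rw [List.map_reverse (f := fun i => (J i : ℕ)), List.sum_reverse, hsum, two_mul, pow_add]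
  have h1 := (hc hy).pow_right (ell J)
  have h2 := hc hm
  have h3 := hμ.pow_right (ell J)
  have h4 := hgm.pow_left (ell J)
  rw [List.map_reverse] at *
  generalize ((List.finRange n).map fun i => y (Fin.castLE h i).rev ^ (J i : ℕ)).reverse.prod = r
    at *
  generalize ((List.finRange n).map fun i => y (Fin.castLE h i) ^ (J i : ℕ)).prod = l at *
  generalize g ^ ell J = G at *
  calc l * G * (μ * m) * (r * G) = l * (G * μ) * (m * r) * G := by simp only [mul_assoc]
    _ = l * μ * (G * r) * (m * G) := by rw [← h3.eq, ← h2.eq]; simp only [mul_assoc]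
    _ = _ := by rw [← h1.eq]; simp only [mul_assoc]; rw [← mul_assoc G, h4.eq, mul_assoc]

end Nested

/-! ### A nontrivial representation by block matrices. -/

section Model

open Matrix

variable {B : Type} [Ring B] [Algebra ℂ B] {N : ℕ} (q c : ℂ) (y : Fin N → B)

/-- The `2 × 2` matrix `diag(r b, b)`. -/
def twistedDiag (r : ℂ) (b : B) : Matrix (Fin 2) (Fin 2) B := !![r • b, 0; 0, b]

/-- A Clifford family of length `N + 2` in the `2 × 2` matrices over an algebra containing one of
length `N`. -/
def extendFamily : Fin (N + 2) → Matrix (Fin 2) (Fin 2) B :=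
  Fin.snoc (α := fun _ => Matrix (Fin 2) (Fin 2) B)
    (Fin.cons !![0, 1; 0, 0] fun i => twistedDiag (-q ^ 2) (y i) :
      Fin (N + 1) → Matrix (Fin 2) (Fin 2) B)
    !![0, 0; (c ^ 2 * (1 + q ^ 2) * q ^ N) • 1, 0]

theorem extendFamily_zero : extendFamily q c y 0 = !![0, 1; 0, 0] := by
  rw [extendFamily, ← Fin.castSucc_zero, Fin.snoc_castSucc, Fin.cons_zero]

theorem extendFamily_last :
    extendFamily q c y (Fin.last _) = !![0, 0; (c ^ 2 * (1 + q ^ 2) * q ^ N) • 1, 0] := by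
  rw [extendFamily, Fin.snoc_last]

theorem extendFamily_succ (i : Fin N) :
    extendFamily q c y i.succ.castSucc = twistedDiag (-q ^ 2) (y i) := by
  rw [extendFamily, Fin.snoc_castSucc, Fin.cons_succ]

theorem twistedDiag_mul (r s : ℂ) (a b : B) :
    twistedDiag r a * twistedDiag s b = twistedDiag (r * s) (a * b) := by
  simp [twistedDiag, smul_smul]

theorem twistedDiag_add (r : ℂ) (a b : B) :
    twistedDiag r (a + b) = twistedDiag r a + twistedDiag r b := by
  ext i j; fin_cases i <;> fin_cases j <;> simp [twistedDiag]

theorem twistedDiag_smul (r s : ℂ) (a : B) : twistedDiag r (s • a) = s • twistedDiag r a := by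
  ext i j; fin_cases i <;> fin_cases j <;> simp [twistedDiag]
  exact smul_comm _ _ _

theorem twistedDiag_zero (r : ℂ) : twistedDiag r (0 : B) = 0 := by
  ext i j; fin_cases i <;> fin_cases j <;> simp [twistedDiag]

theorem twistedDiag_sum {ι : Type*} (s : Finset ι) (r : ℂ) (f : ι → B) :
    twistedDiag r (∑ k ∈ s, f k) = ∑ k ∈ s, twistedDiag r (f k) := by
  classical
  induction s using Finset.induction_on with
  | empty => simp [twistedDiag_zero]
  | insert a s ha ih => rw [Finset.sum_insert ha, Finset.sum_insert ha, twistedDiag_add, ih]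

variable {q c y}

theorem metricDef_extendFamily (hq0 : q ≠ 0) (t : ℕ) (ht : t ≤ N) :
    metricDef q c (extendFamily q c y) (t + 1) = twistedDiag (q ^ 4) (metricDef q c y t) := by
  have hs : metricSum q (extendFamily q c y) (t + 1) =
      (c ^ 2 * (1 + q ^ 2)) • !![1, 0; 0, 0] + twistedDiag (q ^ 4) (metricSum q y t) := by
    rw [metricSum, Fin.sum_univ_castSucc, Fin.sum_univ_succ, metricSum, twistedDiag_sum]
    have hlast : ¬ (N + 1 < t + 1) := by omega
    simp only [Fin.val_last, hlast, if_false, add_zero, Fin.castSucc_zero, Fin.val_zero,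
      if_true, Fin.rev_zero, twoRho_zero, zero_lt_iff, ne_eq, Nat.add_eq_zero_iff,
      one_ne_zero, and_false, not_false_iff, extendFamily_zero, extendFamily_last]
    congr 1
    · have : q ^ (-(N : ℤ)) * (c ^ 2 * (1 + q ^ 2) * q ^ N) = c ^ 2 * (1 + q ^ 2) := by
        rw [_root_.zpow_neg, zpow_natCast]
        field_simp
      ext i j
      fin_cases i <;> fin_cases j <;> simp [-_root_.zpow_neg, smul_smul, this]
    · refine Finset.sum_congr rfl fun k _ => ?_
      rw [rev_succ_castSucc, twoRho_succ_castSucc, extendFamily_succ, extendFamily_succ,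
        twistedDiag_mul]
      simp only [Fin.val_castSucc, Fin.val_succ, Nat.add_lt_add_iff_right]
      split_ifs
      · rw [twistedDiag_smul]; congr 2; ring
      · rw [twistedDiag_zero]
  rw [metricDef, metricDef, hs, twistedDiag_add, twistedDiag_smul, smul_add, ← add_assoc]
  congr 1
  ext i j
  fin_cases i <;> fin_cases j <;>
    simp [twistedDiag, Algebra.algebraMap_eq_smul_one]
  module

/-- This inverts the peeling: here `p` is the matrix unit `diag(1, 0)`, so `diag(r b, b)` is `b
r^p`, and the inner generators are rescaled back by `(-q²)^p`. -/
theorem IsCliffordFamily.extend (h : IsCliffordFamily q c y) (hq0 : q ≠ 0) :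
    IsCliffordFamily q c (extendFamily q c y) := by
  have hq2 : (-q ^ 2) * (-q ^ 2) = q ^ 4 := by ring
  constructor
  · intro i j
    induction i using forall_fin_add_two with
    | h0 =>
      induction j using forall_fin_add_two with
      | h0 => simp
      | hl => simp
      | hs j =>
        intro _ _
        rw [extendFamily_zero, extendFamily_succ]
        ext i j; fin_cases i <;> fin_cases j <;> simp [twistedDiag]
    | hl => exact fun hij => absurd hij (Fin.le_last j).not_gt
    | hs i =>
      induction j using forall_fin_add_two with
      | h0 => simp
      | hl =>
        intro _ _
        rw [extendFamily_last, extendFamily_succ]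
        ext i j; fin_cases i <;> fin_cases j <;>
          simp [twistedDiag]
        module
      | hs j =>
        intro hij hr
        rw [extendFamily_succ, extendFamily_succ, twistedDiag_mul, twistedDiag_mul,
          h.anti i j (by simpa using hij) (by rintro rfl; exact hr (rev_succ_castSucc j).symm),
          twistedDiag_smul]
  · intro i
    induction i using forall_fin_add_two with
    | h0 =>
      intro _
      rw [extendFamily_zero]
      ext i j; fin_cases i <;> fin_cases j <;> simp
    | hl =>
      intro _
      rw [extendFamily_last]
      ext i j; fin_cases i <;> fin_cases j <;> simp
    | hs i =>
      intro hr
      rw [extendFamily_succ, twistedDiag_mul, h.sq i, twistedDiag_zero]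
      intro hi
      rw [rev_succ_castSucc, ← hi] at hr
      exact hr rfl
  · intro i
    induction i using forall_fin_add_two with
    | h0 =>
      intro _
      rw [Fin.rev_zero, extendFamily_zero, extendFamily_last, twoRho_zero, Fin.val_zero,
        metricDef_zero, zpow_natCast]
      ext i j; fin_cases i <;> fin_cases j <;> simp [smul_smul, mul_comm]
    | hl => intro hi; rw [Fin.rev_last] at hi; simp at hi
    | hs i =>
      intro hi
      rw [rev_succ_castSucc] at hi ⊢
      rw [extendFamily_succ, extendFamily_succ, twistedDiag_mul, twistedDiag_mul,
        ← twistedDiag_add, h.mixed i (by simpa using hi), twistedDiag_smul, twoRho_succ_castSucc,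
        Fin.val_castSucc, Fin.val_succ, metricDef_extendFamily hq0 _ i.2.le, hq2]
  · intro i
    induction i using forall_fin_add_two with
    | h0 => intro hi; rw [Fin.rev_zero] at hi; simp [Fin.ext_iff] at hi
    | hl => intro hi; rw [Fin.rev_last] at hi; simp [Fin.ext_iff] at hi
    | hs i =>
      intro hi
      rw [rev_succ_castSucc] at hi
      rw [extendFamily_succ, twistedDiag_mul, ← twistedDiag_smul, h.mid i (by simpa using hi),
        Fin.val_castSucc, Fin.val_succ, metricDef_extendFamily hq0 _ i.2.le, hq2]

end Model

theorem exists_isCliffordFamily {q : ℂ} (c : ℂ) (hq0 : q ≠ 0) (N : ℕ) :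
    ∃ (B : Type) (_ : Ring B) (_ : Algebra ℂ B) (_ : Nontrivial B) (x : Fin N → B),
      IsCliffordFamily q c x := by
  induction N using Nat.twoStepInduction with
  | zero =>
    exact ⟨ℂ, inferInstance, inferInstance, inferInstance, Fin.elim0,
      ⟨fun i => i.elim0, fun i => i.elim0, fun i => i.elim0, fun i => i.elim0⟩⟩
  | one =>
    refine ⟨ℂ, inferInstance, inferInstance, inferInstance, fun _ => c, ⟨?_, ?_, ?_, ?_⟩⟩
    · intro i j hij; exact absurd hij (by simp [Subsingleton.elim i j])
    · intro i hi; exact absurd (Subsingleton.elim _ _) hi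
    · intro i hi; exact absurd hi (by simp [Subsingleton.elim i.rev i])
    · intro i _
      rw [Subsingleton.elim i 0, Fin.val_zero, metricDef, metricSum_zero]
      simp; ring
  | more N ih _ =>
    obtain ⟨B, _, _, _, x, hx⟩ := ih
    exact ⟨Matrix (Fin 2) (Fin 2) B, inferInstance, inferInstance, inferInstance,
      extendFamily q c x, hx.extend hq0⟩

/-! ### Recursion for the explicit elements, their squares and the centers. -/

section Recursion

variable {A : Type*} [Ring A] [Algebra ℂ A] {q c : ℂ}

theorem sum_cons {M : Type*} [AddCommMonoid M] {n : ℕ} (f : (Fin (n + 1) → Fin 2) → M) :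
    ∑ J, f J = ∑ J : Fin n → Fin 2,
      (f (Fin.cons 0 J : Fin (n + 1) → Fin 2) + f (Fin.cons 1 J : Fin (n + 1) → Fin 2)) := by
  rw [← (Fin.consEquiv fun _ : Fin (n + 1) => Fin 2).sum_comp, Fintype.sum_prod_type,
    Fin.sum_univ_two, ← Finset.sum_add_distrib]
  rfl

theorem IsCliffordFamily.outerPow_pow {N : ℕ} {x : Fin (N + 2) → A} (h : IsCliffordFamily q c x)
    (hq0 : q ≠ 0) (hD : c ^ 2 * (1 + q ^ 2) ≠ 0) (r : ℂ) (e : ℕ) :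
    outerPow q c x r ^ e = outerPow q c x (r ^ e) := by
  induction e with
  | zero => simp [outerPow_one]
  | succ e ih => rw [pow_succ, ih, h.outerPow_mul hq0 hD, pow_succ]

/-- For fixed inner `J` with `ℓ(J) = k`, the choice `j = 0` contributes `a_k (m q^{4k})^p`, and `j =
1` contributes `a_{k+1} q^{2k-2n} d p`, both multiplying the same inner nested product. Hypothesis
`ha` compares coefficients of `p` with those of `a_k r^p`. -/
theorem IsCliffordFamily.nestedSum_succ {n N : ℕ} {x : Fin (N + 2) → A}
    (h : IsCliffordFamily q c x) (hq0 : q ≠ 0) (hD : c ^ 2 * (1 + q ^ 2) ≠ 0)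
    (hn : n ≤ N) (h' : n + 1 ≤ N + 2) (a : ℕ → ℂ) {μ : A} (hμ0 : Commute μ (x 0))
    (hμl : Commute μ (x (Fin.last _))) (m r : ℂ)
    (ha : ∀ k, a k * (m * q ^ (4 * k) - 1) +
      a (k + 1) * (q ^ (2 * (k : ℤ) - 2 * n) * (c ^ 2 * (1 + q ^ 2) * q ^ N)) = a k * (r - 1)) :
    nestedSum q a h' x (μ * outerPow q c x m) =
      nestedSum q a hn (inner q c x) μ * outerPow q c x r := by
  have hμ : ∀ s, Commute μ (outerPow q c x s) := fun s =>
    (Commute.one_right _).add_right (((hμ0.mul_right hμl).smul_right _).smul_right _)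
  have hx : (fun i : Fin N => x i.succ.castSucc) =
      fun i => inner q c x i * outerPow q c x (-q ^ 2) :=
    funext fun i => h.succ_eq_inner_mul hq0 hD i
  have hnest : ∀ J : Fin n → Fin 2,
      nested hn (fun i => x i.succ.castSucc) (μ * outerPow q c x m) J =
        nested hn (inner q c x) μ J * outerPow q c x (m * q ^ (4 * ell J)) := by
    intro J
    rw [hx, nested_mul hn (inner q c x) μ (outerPow q c x m) (outerPow q c x (-q ^ 2)) J
      (fun i => h.inner_comm_outerPow hq0 hD i _) (hμ _)
      (fun i => h.inner_comm_outerPow hq0 hD i _), h.outerPow_pow hq0 hD, h.outerPow_mul hq0 hD]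
    · congr 3
      rw [pow_mul, neg_sq, ← pow_mul, ← pow_mul]
      ring
    · rw [Commute, SemiconjBy, h.outerPow_mul hq0 hD, h.outerPow_mul hq0 hD, mul_comm]
  have hone : ∀ J : Fin n → Fin 2,
      x 0 * (nested hn (inner q c x) μ J * outerPow q c x (m * q ^ (4 * ell J))) *
        x (Fin.last _) = nested hn (inner q c x) μ J *
          ((c ^ 2 * (1 + q ^ 2) * q ^ N) • outerIdem q c x) := by
    intro J
    rw [← mul_assoc, mul_assoc, h.outerPow_mul_last, ← (nested_commute hn (inner q c x) μ J
      (fun i => h.inner_comm_zero hq0 hD i) hμ0).eq, mul_assoc, outerIdem, smul_smul,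
      mul_inv_cancel₀ (mul_ne_zero hD (pow_ne_zero _ hq0)), one_smul]
  rw [nestedSum, sum_cons, nestedSum, Finset.sum_mul]
  refine Finset.sum_congr rfl fun J _ => ?_
  rw [nested_cons hn, nested_cons hn, hnest]
  simp only [Fin.val_zero, Fin.val_one, pow_zero, pow_one, one_mul, mul_one]
  rw [hone, ell_cons, ell_cons, bigL_cons, bigL_cons]
  generalize nested hn (inner q c x) μ J = w
  generalize ell J = k at *
  generalize bigL J = l
  -- The exponent `2L - k(2n - k + 1)` is unchanged for `j = 0` and grows by `2k - 2n` for `j = 1`.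
  have e0 : 2 * (((((0 : Fin 2) : ℕ) + k + l : ℕ)) : ℤ) -
      ((((0 : Fin 2) : ℕ) + k : ℕ) : ℤ) * (2 * ((n + 1 : ℕ) : ℤ) -
        ((((0 : Fin 2) : ℕ) + k : ℕ) : ℤ) + 1) = 2 * (l : ℤ) - k * (2 * (n : ℤ) - k + 1) := by
    push_cast [Fin.val_zero]; ring
  have e1 : 2 * (((((1 : Fin 2) : ℕ) + k + l : ℕ)) : ℤ) -
      ((((1 : Fin 2) : ℕ) + k : ℕ) : ℤ) * (2 * ((n + 1 : ℕ) : ℤ) -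
        ((((1 : Fin 2) : ℕ) + k : ℕ) : ℤ) + 1) =
        (2 * (l : ℤ) - k * (2 * (n : ℤ) - k + 1)) + (2 * (k : ℤ) - 2 * n) := by
    push_cast [Fin.val_one]; ring
  rw [e0, e1, zpow_add₀ hq0]
  have hk := ha k
  generalize q ^ (2 * (l : ℤ) - k * (2 * (n : ℤ) - k + 1)) = W
  generalize q ^ (2 * (k : ℤ) - 2 * n) = V at *
  generalize c ^ 2 * (1 + q ^ 2) * q ^ N = d at *
  simp only [Fin.val_zero, Fin.val_one, zero_add, add_comm 1 k, outerPow, mul_add, mul_one,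
    mul_smul_comm, smul_mul_assoc]
  linear_combination (norm := module) hk • W • (w * outerIdem q c x)

/-- The coefficients of the element anticommuting with all generators, for even length. -/
def evenCoeff (q c : ℂ) (k : ℕ) : ℂ :=
  (-1 : ℂ) ^ k * ∏ l ∈ Finset.Icc 1 k,
    (q ^ (2 * (l : ℤ) - 2) + q ^ (-2 * (l : ℤ) + 2)) / (q * (q + q⁻¹) * c ^ 2)

/-- The coefficients of the central element, for odd length. -/
def oddCoeff (q c : ℂ) (k : ℕ) : ℂ :=
  ∏ l ∈ Finset.Icc 1 k,
    (q ^ (2 * (l : ℤ) - 1) + q ^ (-2 * (l : ℤ) + 1)) / (q * (q + q⁻¹) * c ^ 2)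

theorem mul_add_inv_eq (hq0 : q ≠ 0) : q * (q + q⁻¹) * c ^ 2 = c ^ 2 * (1 + q ^ 2) := by
  field_simp; ring

/-- After division by `a_k` this is `(q^{4k} - 1) - (q^{4k} + 1) = -2`, the case `m = 1`, `r = -1`.
-/
theorem evenCoeff_rec (hq0 : q ≠ 0) (hD : c ^ 2 * (1 + q ^ 2) ≠ 0) (n k : ℕ) :
    evenCoeff q c k * (1 * q ^ (4 * k) - 1) +
      evenCoeff q c (k + 1) *
        (q ^ (2 * (k : ℤ) - 2 * n) * (c ^ 2 * (1 + q ^ 2) * q ^ (2 * n))) =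
      evenCoeff q c k * (-1 - 1) := by
  have h1 : q ^ (2 * ((k + 1 : ℕ) : ℤ) - 2) = q ^ (2 * k) := by
    rw [← zpow_natCast]; congr 1; push_cast; ring
  have h2 : q ^ (-2 * ((k + 1 : ℕ) : ℤ) + 2) = (q ^ (2 * k))⁻¹ := by
    rw [← zpow_natCast, ← zpow_neg]; congr 1; push_cast; ring
  have h3 : q ^ (2 * (k : ℤ) - 2 * n) = q ^ (2 * k) * (q ^ (2 * n))⁻¹ := by
    rw [← zpow_natCast, ← zpow_natCast, ← zpow_neg, ← zpow_add₀ hq0]; congr 1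
  have h4 : q ^ (4 * k) = q ^ (2 * k) * q ^ (2 * k) := by rw [← pow_add]; congr 1; ring
  have hk : q ^ (2 * k) ≠ 0 := pow_ne_zero _ hq0
  have hn : q ^ (2 * n) ≠ 0 := pow_ne_zero _ hq0
  rw [evenCoeff, evenCoeff, Finset.prod_Icc_succ_top (by omega), mul_add_inv_eq hq0, h1, h2, h3,
    h4, pow_succ (-1 : ℂ) k]
  generalize (∏ l ∈ Finset.Icc 1 k, _ : ℂ) = P
  generalize c ^ 2 * (1 + q ^ 2) = d at *
  generalize q ^ (2 * k) = K at *
  generalize q ^ (2 * n) = M at *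
  field_simp
  ring

/-- The case `m = -q²`, `r = 1`: the middle generator itself carries a factor `(-q²)^p`, and the
coefficients are such that all powers of `p` cancel. -/
theorem oddCoeff_rec (hq0 : q ≠ 0) (hD : c ^ 2 * (1 + q ^ 2) ≠ 0) (n k : ℕ) :
    oddCoeff q c k * (-q ^ 2 * q ^ (4 * k) - 1) +
      oddCoeff q c (k + 1) *
        (q ^ (2 * (k : ℤ) - 2 * n) * (c ^ 2 * (1 + q ^ 2) * q ^ (2 * n + 1))) =
      oddCoeff q c k * (1 - 1) := by
  have h1 : q ^ (2 * ((k + 1 : ℕ) : ℤ) - 1) = q ^ (2 * k) * q := by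
    rw [← pow_succ, ← zpow_natCast]; congr 1; push_cast; ring
  have h2 : q ^ (-2 * ((k + 1 : ℕ) : ℤ) + 1) = (q ^ (2 * k) * q)⁻¹ := by
    rw [← pow_succ, ← zpow_natCast, ← zpow_neg]; congr 1
  have h3 : q ^ (2 * (k : ℤ) - 2 * n) = q ^ (2 * k) * (q ^ (2 * n))⁻¹ := by
    rw [← zpow_natCast, ← zpow_natCast, ← zpow_neg, ← zpow_add₀ hq0]; congr 1
  have h4 : q ^ (4 * k) = q ^ (2 * k) * q ^ (2 * k) := by rw [← pow_add]; congr 1; ring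
  have hk : q ^ (2 * k) ≠ 0 := pow_ne_zero _ hq0
  have hn : q ^ (2 * n) ≠ 0 := pow_ne_zero _ hq0
  rw [oddCoeff, oddCoeff, Finset.prod_Icc_succ_top (by omega), mul_add_inv_eq hq0, h1, h2, h3,
    h4, pow_succ q (2 * n)]
  generalize (∏ l ∈ Finset.Icc 1 k, _ : ℂ) = P
  generalize c ^ 2 * (1 + q ^ 2) = d at *
  generalize q ^ (2 * k) = K at *
  generalize q ^ (2 * n) = M at *
  field_simp
  ring

namespace IsCliffordFamily

theorem nestedSum_even_succ {n : ℕ} {x : Fin (2 * n + 2) → A} (h : IsCliffordFamily q c x)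
    (hq0 : q ≠ 0) (hD : c ^ 2 * (1 + q ^ 2) ≠ 0) (h₁ : n + 1 ≤ 2 * n + 2) (h₂ : n ≤ 2 * n) :
    nestedSum q (evenCoeff q c) h₁ x 1 =
      nestedSum q (evenCoeff q c) h₂ (inner q c x) 1 * outerPow q c x (-1) := by
  have := h.nestedSum_succ hq0 hD h₂ h₁ (evenCoeff q c) (Commute.one_left _) (Commute.one_left _)
    1 (-1) (evenCoeff_rec hq0 hD n)
  rwa [outerPow_one, mul_one] at this

theorem nestedSum_odd_succ {n : ℕ} {x : Fin (2 * n + 1 + 2) → A} (h : IsCliffordFamily q c x)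
    (hq0 : q ≠ 0) (hD : c ^ 2 * (1 + q ^ 2) ≠ 0) (h₁ : n + 1 ≤ 2 * n + 1 + 2)
    (h₂ : n ≤ 2 * n + 1) (i : Fin (2 * n + 1)) :
    nestedSum q (oddCoeff q c) h₁ x (x i.succ.castSucc) =
      nestedSum q (oddCoeff q c) h₂ (inner q c x) (inner q c x i) := by
  rw [h.succ_eq_inner_mul hq0 hD, h.nestedSum_succ hq0 hD h₂ h₁ (oddCoeff q c)
    (h.inner_comm_zero hq0 hD i) (h.inner_comm_last hq0 hD i) (-q ^ 2) 1 (oddCoeff_rec hq0 hD n),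
    outerPow_one, mul_one]

omit [Algebra ℂ A] in
theorem _root_.FRTClifford.nested_mem {S : Type*} [SetLike S A] [SubmonoidClass S A] {s : S}
    {n N : ℕ} (h : n ≤ N) {x : Fin N → A} {μ : A} (hx : ∀ i, x i ∈ s) (hμ : μ ∈ s)
    (J : Fin n → Fin 2) : nested h x μ J ∈ s := by
  refine mul_mem (mul_mem (list_prod_mem ?_) hμ) (list_prod_mem ?_)
  all_goals
    intro z hz
    obtain ⟨k, -, rfl⟩ := List.mem_map.1 hz
    exact pow_mem (hx _) _

theorem _root_.FRTClifford.nestedSum_mem {s : Subalgebra ℂ A} (a : ℕ → ℂ) {n N : ℕ} (h : n ≤ N)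
    {x : Fin N → A} {μ : A} (hx : ∀ i, x i ∈ s) (hμ : μ ∈ s) : nestedSum q a h x μ ∈ s :=
  sum_mem fun J _ => s.smul_mem (nested_mem h hx hμ J) _

theorem _root_.FRTClifford.nestedSum_mem_adjoin (a : ℕ → ℂ) {n N : ℕ} (h : n ≤ N) (x : Fin N → A)
    {μ : A} (hμ : μ ∈ Algebra.adjoin ℂ (Set.range x)) :
    nestedSum q a h x μ ∈ Algebra.adjoin ℂ (Set.range x) :=
  nestedSum_mem a h (fun i => Algebra.subset_adjoin ⟨i, rfl⟩) hμ

/-- Since `(-1)^p` is `-1` to the left of `u` and `1` to its right, and the reverse for `w`, it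
anticommutes with the outer pair. It commutes with the other generators, for which the inner factor
supplies the sign. -/
theorem nestedSum_even_anticomm {n : ℕ} {x : Fin (2 * n) → A} (h : IsCliffordFamily q c x)
    (hq0 : q ≠ 0) (hD : c ^ 2 * (1 + q ^ 2) ≠ 0) (hn : n ≤ 2 * n) (i : Fin (2 * n)) :
    nestedSum q (evenCoeff q c) hn x 1 * x i = -(x i * nestedSum q (evenCoeff q c) hn x 1) := by
  induction n with
  | zero => exact i.elim0
  | succ n ih =>
    have hz := h.nestedSum_even_succ hq0 hD hn (by omega)
    have hmem := nestedSum_mem_adjoin (q := q) (evenCoeff q c) (by omega : n ≤ 2 * n)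
      (inner q c x) (Subalgebra.one_mem _)
    have ih' := ih (h.inner hq0 hD) (by omega)
    have h0 := h.adjoin_inner_comm_zero hq0 hD hmem
    have hl := h.adjoin_inner_comm_last hq0 hD hmem
    have hG := h.adjoin_inner_comm_outerPow hq0 hD hmem
    change nestedSum q (evenCoeff q c) hn x 1 = _ at hz
    rw [hz]
    generalize nestedSum q (evenCoeff q c) (by omega : n ≤ 2 * n) (inner q c x) 1 = Z at *
    revert i
    refine forall_fin_add_two ?_ ?_ ?_
    · rw [mul_assoc, h.outerPow_mul_zero hq0 hD, ← mul_assoc, ← h0.eq, mul_assoc,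
        h.zero_mul_outerPow]
      simp
    · rw [mul_assoc, h.outerPow_mul_last, ← mul_assoc, ← hl.eq, mul_assoc,
        h.last_mul_outerPow hq0 hD]
      simp
    · intro i
      rw [mul_assoc, (h.outerPow_comm_succ _ i).eq, ← mul_assoc, ← mul_assoc, ← neg_mul]
      congr 1
      rw [h.succ_eq_inner_mul hq0 hD, ← mul_assoc, ih' i, mul_assoc _ _ Z, ← (hG _).eq, neg_mul,
        mul_assoc]

theorem nestedSum_even_sq {n : ℕ} {x : Fin (2 * n) → A} (h : IsCliffordFamily q c x)
    (hq0 : q ≠ 0) (hD : c ^ 2 * (1 + q ^ 2) ≠ 0) (hn : n ≤ 2 * n) :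
    nestedSum q (evenCoeff q c) hn x 1 * nestedSum q (evenCoeff q c) hn x 1 = 1 := by
  induction n with
  | zero => simp [nestedSum, nested, ell, bigL, evenCoeff]
  | succ n ih =>
    have hz := h.nestedSum_even_succ hq0 hD hn (by omega)
    have hmem := nestedSum_mem_adjoin (q := q) (evenCoeff q c) (by omega : n ≤ 2 * n)
      (inner q c x) (Subalgebra.one_mem _)
    have hG := h.adjoin_inner_comm_outerPow hq0 hD hmem
    change nestedSum q (evenCoeff q c) hn x 1 = _ at hz
    rw [hz, ← mul_assoc, mul_assoc _ (outerPow q c x (-1)), ← (hG _).eq, ← mul_assoc,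
      ih (h.inner hq0 hD), one_mul, h.outerPow_mul hq0 hD, neg_mul_neg, one_mul, outerPow_one]

theorem mem_bot_of_commute {n : ℕ} {x : Fin (2 * n) → A} (h : IsCliffordFamily q c x)
    (hq0 : q ≠ 0) (hD : c ^ 2 * (1 + q ^ 2) ≠ 0) {z : A}
    (hz : z ∈ Algebra.adjoin ℂ (Set.range x)) (hc : ∀ i, Commute z (x i)) :
    z ∈ (⊥ : Subalgebra ℂ A) := by
  induction n with
  | zero =>
    have : Set.range x = ∅ := Set.eq_empty_of_forall_notMem fun _ ⟨i, _⟩ => i.elim0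
    rwa [this, Algebra.adjoin_empty] at hz
  | succ n ih =>
    exact ih (h.inner hq0 hD) (h.mem_adjoin_inner hq0 hD hz hc) (commute_inner hc)

theorem nestedSum_odd_zero {x : Fin (2 * 0 + 1) → A} (hn : 0 ≤ 2 * 0 + 1) (i : Fin (2 * 0 + 1)) :
    nestedSum q (oddCoeff q c) hn x (x i) = x i := by
  simp [nestedSum, nested, ell, bigL, oddCoeff]

theorem mem_adjoin_of_commute {n : ℕ} {x : Fin (2 * n + 1) → A} (h : IsCliffordFamily q c x)
    (hq0 : q ≠ 0) (hD : c ^ 2 * (1 + q ^ 2) ≠ 0) (hn : n ≤ 2 * n + 1) (hn' : n < 2 * n + 1) {z : A}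
    (hz : z ∈ Algebra.adjoin ℂ (Set.range x)) (hc : ∀ i, Commute z (x i)) :
    z ∈ Algebra.adjoin ℂ {nestedSum q (oddCoeff q c) hn x (x ⟨n, hn'⟩)} := by
  induction n with
  | zero =>
    have : Set.range x = {x ⟨0, hn'⟩} := by
      ext y
      simp only [Set.mem_range, Set.mem_singleton_iff]
      constructor
      · rintro ⟨i, rfl⟩
        exact congrArg x (Subsingleton.elim (α := Fin 1) _ _)
      · rintro rfl
        exact ⟨_, rfl⟩
    rwa [nestedSum_odd_zero, ← this]
  | succ n ih =>
    have hs := h.nestedSum_odd_succ hq0 hD hn (by omega) ⟨n, by omega⟩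
    change nestedSum q (oddCoeff q c) hn x (x ⟨n + 1, hn'⟩) = _ at hs
    rw [hs]
    exact ih (h.inner hq0 hD) _ _ (h.mem_adjoin_inner hq0 hD hz hc) (commute_inner hc)

theorem nestedSum_odd_comm {n : ℕ} {x : Fin (2 * n + 1) → A} (h : IsCliffordFamily q c x)
    (hq0 : q ≠ 0) (hD : c ^ 2 * (1 + q ^ 2) ≠ 0) (hn : n ≤ 2 * n + 1) (hn' : n < 2 * n + 1)
    (i : Fin (2 * n + 1)) :
    Commute (nestedSum q (oddCoeff q c) hn x (x ⟨n, hn'⟩)) (x i) := by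
  induction n with
  | zero =>
    rw [nestedSum_odd_zero, Subsingleton.elim (α := Fin 1) i ⟨0, hn'⟩]
  | succ n ih =>
    have hs := h.nestedSum_odd_succ hq0 hD hn (by omega) ⟨n, by omega⟩
    change nestedSum q (oddCoeff q c) hn x (x ⟨n + 1, hn'⟩) = _ at hs
    rw [hs]
    have hmem := nestedSum_mem_adjoin (q := q) (oddCoeff q c) (by omega : n ≤ 2 * n + 1)
      (inner q c x) (Algebra.subset_adjoin ⟨⟨n, by omega⟩, rfl⟩)
    revert i
    refine forall_fin_add_two ?_ ?_ ?_
    · exact h.adjoin_inner_comm_zero hq0 hD hmem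
    · exact h.adjoin_inner_comm_last hq0 hD hmem
    · intro i
      rw [h.succ_eq_inner_mul hq0 hD]
      exact (ih (h.inner hq0 hD) _ _ i).mul_right (h.adjoin_inner_comm_outerPow hq0 hD hmem _)

/-- The element is unchanged by peeling, so its square is that of the last remaining middle
generator, given by `mid` after cancelling `1 + q²`. -/
theorem nestedSum_odd_sq {n : ℕ} {x : Fin (2 * n + 1) → A} (h : IsCliffordFamily q c x)
    (hq0 : q ≠ 0) (hD : c ^ 2 * (1 + q ^ 2) ≠ 0) (hn : n ≤ 2 * n + 1) (hn' : n < 2 * n + 1) :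
    nestedSum q (oddCoeff q c) hn x (x ⟨n, hn'⟩) * nestedSum q (oddCoeff q c) hn x (x ⟨n, hn'⟩)
      = c ^ 2 • (1 : A) := by
  induction n with
  | zero =>
    have hm := h.mid ⟨0, hn'⟩ (Subsingleton.elim (α := Fin 1) _ _)
    rw [metricDef, metricSum_zero, smul_zero, add_zero, Algebra.algebraMap_eq_smul_one,
      mul_comm (c ^ 2), mul_smul] at hm
    rw [nestedSum_odd_zero]
    exact smul_right_injective A (right_ne_zero_of_mul hD) hm
  | succ n ih =>
    have hs := h.nestedSum_odd_succ hq0 hD hn (by omega) ⟨n, by omega⟩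
    change nestedSum q (oddCoeff q c) hn x (x ⟨n + 1, hn'⟩) = _ at hs
    rw [hs]
    exact ih (h.inner hq0 hD) _ _

end IsCliffordFamily

end Recursion

/-! ### Transfer to the presented algebra; parity. -/

section Algebra

variable {q c : ℂ} {N : ℕ}

theorem isCliffordFamily_gam (c : ℂ) (hq0 : q ≠ 0) (hq : ∀ m : ℕ, 1 ≤ m → q ^ m ≠ 1)
    (hN : 1 ≤ N) : IsCliffordFamily q c (gam q c : Fin N → Cl q c N) := by
  refine isCliffordFamily_of_relations hq0 hq hN (fun i j => ?_) ?_
  · have := RingQuot.mkAlgHom_rel ℂ (Rel.projPlus (q := q) (c := c) i j)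
    simp only [map_sum, map_smul, map_mul, map_zero] at this
    exact this
  · have := RingQuot.mkAlgHom_rel ℂ (Rel.metric (q := q) (c := c) (N := N))
    simp only [map_sum, map_smul, map_mul (RingQuot.mkAlgHom ℂ (Rel q c N)),
      AlgHom.commutes] at this
    exact this

theorem IsCliffordFamily.exists_algHom {A : Type*} [Ring A] [Algebra ℂ A] {x : Fin N → A}
    (h : IsCliffordFamily q c x) (hq0 : q ≠ 0) (hq : ∀ m : ℕ, 1 ≤ m → q ^ m ≠ 1) :
    ∃ φ : Cl q c N →ₐ[ℂ] A, ∀ i, φ (gam q c i) = x i := by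
  refine ⟨RingQuot.liftAlgHom ℂ ⟨FreeAlgebra.lift ℂ x, ?_⟩, fun i => ?_⟩
  · rintro _ _ (⟨i, j⟩ | _)
    · simpa only [map_sum, map_smul, map_mul, map_zero, FreeAlgebra.lift_ι_apply] using
        h.sum_projPlus_eq_zero hq0 hq i j
    · have := h.metricSum_total hq0 hq
      rw [← FRTClifford.metricSum_total, ← Algebra.algebraMap_eq_smul_one] at this
      simpa only [map_sum, map_smul, map_mul, AlgHom.commutes, FreeAlgebra.lift_ι_apply] using this
  · rw [gam, RingQuot.liftAlgHom_mkAlgHom_apply, FreeAlgebra.lift_ι_apply]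

/-- The relations are even, so changing all signs preserves them; applied to the generators this
yields the parity endomorphism. -/
theorem IsCliffordFamily.neg {A : Type*} [Ring A] [Algebra ℂ A] {x : Fin N → A}
    (h : IsCliffordFamily q c x) : IsCliffordFamily q c (fun i => -x i) := by
  have hm : ∀ t, metricDef q c (fun i => -x i) t = metricDef q c x t := fun t => by
    simp only [metricDef, metricSum, neg_mul_neg]
  constructor
  · simpa only [neg_mul_neg] using h.anti
  · simpa only [neg_mul_neg] using h.sq
  · simpa only [neg_mul_neg, hm] using h.mixed
  · simpa only [neg_mul_neg, hm] using h.mid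

theorem nontrivial_cl (c : ℂ) (hq0 : q ≠ 0) (hq : ∀ m : ℕ, 1 ≤ m → q ^ m ≠ 1) (N : ℕ) :
    Nontrivial (Cl q c N) := by
  obtain ⟨B, _, _, _, x, hx⟩ := exists_isCliffordFamily c hq0 N
  obtain ⟨φ, -⟩ := hx.exists_algHom hq0 hq
  exact φ.toRingHom.domain_nontrivial

theorem adjoin_range_gam : Algebra.adjoin ℂ (Set.range (gam q c : Fin N → Cl q c N)) = ⊤ := by
  have : Set.range (gam q c : Fin N → Cl q c N) =
      RingQuot.mkAlgHom ℂ (Rel q c N) '' Set.range (FreeAlgebra.ι ℂ) := by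
    rw [← Set.range_comp]; rfl
  rw [this, ← AlgHom.map_adjoin, FreeAlgebra.adjoin_range_ι, Algebra.map_top,
    AlgHom.range_eq_top]
  exact RingQuot.mkAlgHom_surjective ℂ _

theorem sum_range_filter_ell {M : Type*} [AddCommMonoid M] [Module ℂ M] (n : ℕ) (a : ℕ → ℂ)
    (w : (Fin n → Fin 2) → ℕ → ℂ) (f : (Fin n → Fin 2) → M) :
    ∑ k ∈ Finset.range (n + 1), a k • ∑ J : Fin n → Fin 2 with ell J = k, w J k • f J =
      ∑ J, (a (ell J) * w J (ell J)) • f J := by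
  rw [← Finset.sum_fiberwise_of_maps_to (s := Finset.univ) (t := Finset.range (n + 1)) (g := ell)
    fun J _ => Finset.mem_range.2 (Nat.lt_succ_of_le (ell_le J))]
  refine Finset.sum_congr rfl fun k _ => ?_
  rw [Finset.smul_sum]
  refine Finset.sum_congr rfl fun J hJ => ?_
  rw [(Finset.mem_filter.1 hJ).2, mul_smul]

theorem z0_eq_nestedSum (n : ℕ) (h : n ≤ 2 * n) :
    z0 q c n = nestedSum q (evenCoeff q c) h (gam q c) 1 := by
  have := sum_range_filter_ell n (evenCoeff q c)
    (fun J k => q ^ (2 * (bigL J : ℤ) - (k : ℤ) * (2 * (n : ℤ) - (k : ℤ) + 1)))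
    (nested h (gam q c : Fin (2 * n) → Cl q c (2 * n)) 1)
  rw [nestedSum, ← this]
  simp only [nested, mul_one]
  rfl

theorem z1_eq_nestedSum (n : ℕ) (h : n ≤ 2 * n + 1) (h' : n < 2 * n + 1) :
    z1 q c n = (1 / c) • nestedSum q (oddCoeff q c) h (gam q c) (gam q c ⟨n, h'⟩) := by
  rw [nestedSum, ← sum_range_filter_ell n (oddCoeff q c)
    (fun J k => q ^ (2 * (bigL J : ℤ) - (k : ℤ) * (2 * (n : ℤ) - (k : ℤ) + 1)))]
  rfl

theorem prod_map_pow_eq {n : ℕ} (g : Fin n → Fin N) (e : Fin n → ℕ) (L : List (Fin n)) :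
    (L.map fun i => gam q c (g i) ^ e i).prod =
      ((L.flatMap fun i => List.replicate (e i) (g i)).map (gam q c)).prod := by
  induction L with
  | nil => simp
  | cons i L ih => simp [ih]

theorem length_flatMap_replicate {n : ℕ} (g : Fin n → Fin N) (e : Fin n → ℕ) (L : List (Fin n)) :
    (L.flatMap fun i => List.replicate (e i) (g i)).length = (L.map e).sum := by
  simp [List.length_flatMap]

theorem nested_gam_mem_oddPart {n : ℕ} (h : n ≤ N) (i : Fin N) (J : Fin n → Fin 2) :
    nested h (gam q c) (gam q c i) J ∈ oddPart q c N := by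
  refine Submodule.subset_span
    ⟨(List.finRange n).flatMap (fun k => List.replicate (J k : ℕ) (Fin.castLE h k)) ++ i ::
      (List.finRange n).reverse.flatMap
        (fun k => List.replicate (J k : ℕ) (Fin.castLE h k).rev), ?_, ?_⟩
  · rw [List.length_append, List.length_cons, length_flatMap_replicate, length_flatMap_replicate,
      List.map_reverse, List.sum_reverse]
    exact ⟨_, by ring⟩
  · rw [nested, prod_map_pow_eq (fun k => Fin.castLE h k),
      prod_map_pow_eq (fun k => (Fin.castLE h k).rev), List.map_append, List.prod_append,
      List.map_cons, List.prod_cons, mul_assoc]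

theorem map_prod_eq_neg {A ι : Type*} [Ring A] [Algebra ℂ A] {x : ι → A} {π : A →ₐ[ℂ] A}
    (hπ : ∀ i, π (x i) = -x i) {w : List ι} (hw : Odd w.length) :
    π (w.map x).prod = -(w.map x).prod := by
  have hlist : ∀ w : List ι, π (w.map x).prod = (-1 : ℂ) ^ w.length • (w.map x).prod := by
    intro w
    induction w with
    | nil => simp
    | cons i w ih =>
      rw [List.map_cons, List.prod_cons, map_mul, hπ, ih, List.length_cons, pow_succ,
        mul_smul_comm]
      simp
  rw [hlist, hw.neg_one_pow, neg_one_smul]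

theorem map_eq_neg_of_mem_oddPart {π : Cl q c N →ₐ[ℂ] Cl q c N}
    (hπ : ∀ i, π (gam q c i) = -gam q c i) {z : Cl q c N} (hz : z ∈ oddPart q c N) :
    π z = -z := by
  induction hz using Submodule.span_induction with
  | mem z hz =>
    obtain ⟨w, hw, rfl⟩ := hz
    exact map_prod_eq_neg hπ hw
  | zero => simp
  | add y z _ _ hy hz => rw [map_add, hy, hz, neg_add]
  | smul a z _ hz => rw [map_smul, hz, smul_neg]

theorem commute_mul_of_anticomm {A : Type*} [Ring A] {x y z : A} (hy : y * x = -(x * y))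
    (hz : z * x = -(x * z)) : Commute (z * y) x := by
  rw [Commute, SemiconjBy, mul_assoc, hy, mul_neg, ← mul_assoc, hz, neg_mul, neg_neg, mul_assoc]

/-- If `y²` is a scalar, every element of the algebra generated by `y` is of the form `a + b y`. -/
theorem exists_of_mem_adjoin_singleton {A : Type*} [Ring A] [Algebra ℂ A] {y z : A} {d : ℂ}
    (hy : y * y = d • (1 : A)) (hz : z ∈ Algebra.adjoin ℂ {y}) :
    ∃ a b : ℂ, z = a • 1 + b • y := by
  induction hz using Algebra.adjoin_induction with
  | mem z hz => exact ⟨0, 1, by rw [Set.mem_singleton_iff.1 hz]; simp⟩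
  | algebraMap r => exact ⟨r, 0, by rw [Algebra.algebraMap_eq_smul_one]; simp⟩
  | add z z' _ _ ih ih' =>
    obtain ⟨a, b, rfl⟩ := ih
    obtain ⟨a', b', rfl⟩ := ih'
    exact ⟨a + a', b + b', by module⟩
  | mul z z' _ _ ih ih' =>
    obtain ⟨a, b, rfl⟩ := ih
    obtain ⟨a', b', rfl⟩ := ih'
    refine ⟨a * a' + b * b' * d, a * b' + b * a', ?_⟩
    simp only [mul_add, add_mul, smul_mul_smul_comm, one_mul, mul_one, hy]
    module

end Algebra

end FRTClifford

end

open FRTClifford in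
theorem mainTheorem9 (q c : ℂ) (hq0 : q ≠ 0) (hq : ∀ m : ℕ, 1 ≤ m → q ^ m ≠ 1)
    (hc : ∃ r : ℝ, r ≠ 0 ∧ c ^ 2 = (r : ℂ)) :
    (∀ n : ℕ, 3 ≤ 2 * n →
      FRTClifford.z0 q c n ≠ 0 ∧
      (∀ i : Fin (2 * n),
        FRTClifford.z0 q c n * FRTClifford.gam q c i =
          -(FRTClifford.gam q c i * FRTClifford.z0 q c n)) ∧
      (∀ z : FRTClifford.Cl q c (2 * n),
        (∀ i : Fin (2 * n), z * FRTClifford.gam q c i = -(FRTClifford.gam q c i * z)) →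
          ∃ a : ℂ, z = a • FRTClifford.z0 q c n)) ∧
    (∀ n : ℕ, 3 ≤ 2 * n + 1 →
      FRTClifford.z1 q c n ∈ FRTClifford.oddPart q c (2 * n + 1) ∧
      FRTClifford.z1 q c n ≠ 0 ∧
      (∀ i : Fin (2 * n + 1),
        FRTClifford.z1 q c n * FRTClifford.gam q c i =
          FRTClifford.gam q c i * FRTClifford.z1 q c n) ∧
      (∀ z ∈ FRTClifford.oddPart q c (2 * n + 1),
        (∀ i : Fin (2 * n + 1), z * FRTClifford.gam q c i = FRTClifford.gam q c i * z) →
          ∃ a : ℂ, z = a • FRTClifford.z1 q c n)) := by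
  have hc0 : c ≠ 0 := by
    rintro rfl
    obtain ⟨r, hr, h⟩ := hc
    exact hr (by simpa using h.symm)
  have hD : c ^ 2 * (1 + q ^ 2) ≠ 0 :=
    mul_ne_zero (pow_ne_zero _ hc0) (one_add_sq_ne_zero hq)
  refine ⟨fun n hn => ?_, fun n hn => ?_⟩
  · have hN := nontrivial_cl c hq0 hq (2 * n)
    have h := isCliffordFamily_gam (N := 2 * n) c hq0 hq (by omega)
    rw [z0_eq_nestedSum n (by omega)]
    have hsq := h.nestedSum_even_sq hq0 hD (by omega)
    have hanti := h.nestedSum_even_anticomm hq0 hD (by omega)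
    generalize nestedSum q (evenCoeff q c) (by omega : n ≤ 2 * n) (gam q c) 1 = Z at *
    refine ⟨?_, hanti, fun z hz => ?_⟩
    · rintro rfl
      rw [zero_mul] at hsq
      exact zero_ne_one hsq
    -- A product of two elements anticommuting with every generator is central, hence a scalar; `Z²
    -- = 1` then recovers `z`.
    · have hzZ : z * Z ∈ (⊥ : Subalgebra ℂ (Cl q c (2 * n))) := by
        refine h.mem_bot_of_commute hq0 hD (by rw [adjoin_range_gam]; trivial) fun i => ?_
        exact commute_mul_of_anticomm (hanti i) (hz i)
      obtain ⟨a, ha⟩ := Algebra.mem_bot.1 hzZ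
      refine ⟨a, ?_⟩
      rw [Algebra.smul_def, ha, mul_assoc, hsq, mul_one]
  · have hN := nontrivial_cl c hq0 hq (2 * n + 1)
    have h := isCliffordFamily_gam (N := 2 * n + 1) c hq0 hq (by omega)
    rw [z1_eq_nestedSum n (by omega) (by omega)]
    have hodd : nestedSum q (oddCoeff q c) (by omega : n ≤ 2 * n + 1) (gam q c)
        (gam q c ⟨n, by omega⟩) ∈ oddPart q c (2 * n + 1) :=
      Submodule.sum_mem _ fun J _ => Submodule.smul_mem _ _ (nested_gam_mem_oddPart _ _ J)
    have hsq := h.nestedSum_odd_sq hq0 hD (by omega) (by omega)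
    have hcomm := h.nestedSum_odd_comm hq0 hD (by omega) (by omega)
    have hcen := fun z => h.mem_adjoin_of_commute hq0 hD (by omega : n ≤ 2 * n + 1) (by omega)
      (z := z) (by rw [adjoin_range_gam]; trivial)
    generalize nestedSum q (oddCoeff q c) (by omega : n ≤ 2 * n + 1) (gam q c)
        (gam q c ⟨n, by omega⟩) = Z at *
    refine ⟨Submodule.smul_mem _ _ hodd, ?_, fun i => ((hcomm i).smul_left _).eq,
      fun z hz hzc => ?_⟩
    · intro h0
      rw [(smul_eq_zero.1 h0).resolve_left (one_div_ne_zero hc0), zero_mul] at hsq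
      exact smul_ne_zero (pow_ne_zero 2 hc0) one_ne_zero hsq.symm
    -- The parity endomorphism negates `z` and `Z` but fixes `1`, so comparing both sides gives `2a
    -- = 0`.
    · obtain ⟨a, b, rfl⟩ := exists_of_mem_adjoin_singleton hsq (hcen z hzc)
      obtain ⟨π, hπ⟩ := h.neg.exists_algHom hq0 hq
      have hp := map_eq_neg_of_mem_oddPart hπ hz
      rw [map_add, map_smul, map_smul, map_one, map_eq_neg_of_mem_oddPart hπ hodd] at hp
      have ha : a • (1 : Cl q c (2 * n + 1)) = 0 := by
        have h2 : (2 : ℂ) • a • (1 : Cl q c (2 * n + 1)) = 0 := by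
          linear_combination (norm := module) hp
        exact (smul_eq_zero.1 h2).resolve_left two_ne_zero
      -- The factor `c` compensates the normalization `1/c` of `z_1`.
      refine ⟨b * c, ?_⟩
      rw [ha, zero_add, smul_smul]
      congr 1
      field_simp
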